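/- Let $\Gamma$ be a finite group, let $d\ge 1$, and let $\pi\colon\Gamma\to\mathrm{GL}_d(\mathbb C)$ be a representation with the following two properties. (P1) The exterior powers $\bigwedge^m\pi$, $0\le m\le d$, are irreducible and pairwise non-isomorphic. (P2) The group $\pi(\Gamma)$ is generated by pseudo-reflections, that is, by matrices $A\in\mathrm{GL}_d(\mathbb C)$ of finite order with $\mathrm{rank}(A-I)=1$. Let $G$ be a finite, connected, undirected graph without loops; multiple edges are allowed. Let $E(G)$ be the set of oriented edges of $G$: each undirected edge gives two oriented edges, $e$ and its reversal $-e$. A $\Gamma$-labeling of $G$ is a function $\gamma\colon E(G)\to\Gamma$ with $\gamma(-e)=\gamma(e)^{-1}$ for all $e$. Its $(\Gamma,\pi)$-covering matrix $A_{\gamma,\pi}$ is the square matrix of size $d\,|V(G)|$ made of $d\times d$ blocks indexed by pairs of vertices, whose $(u,v)$ block is $\sum_{e\colon u\to v}\pi(\gamma(e))$. Let $\rho(G)$ be the spectral radius of the universal covering tree $T$ of $G$, that is, of its adjacency operator $(A_Tf)(x)=\sum_{y\sim x}f(y)$ on $\ell^2(V(T))$. Then $G$ has a one-sided Ramanujan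 $(\Gamma,\pi)$-covering: there is a $\Gamma$-labeling $\gamma$ of $G$ such that all eigenvalues of $A_{\gamma,\pi}$ are real and at most $\rho(G)$. -/

import Mathlib

/-! ### Graphs with chosen orientations -/

/-- An oriented undirected graph, multiple edges and loops allowed: `V` is the set of vertices and
`E` is the set of undirected edges, each taken with one chosen orientation, from `tail e` to
`head e`. -/
structure OrientedGraph (V E : Type*) where
  head : E → V
  tail : E → V

namespace OrientedGraph

variable {V E : Type*}

/-- The set of all oriented edges, the disjoint union of the edges with the chosen orientation
(`Sum.inl`) and of the edges with the opposite orientation (`Sum.inr`). The orientation reversal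
`e ↦ -e` is `Sum.swap`. -/
abbrev Dart (_G : OrientedGraph V E) : Type _ := E ⊕ E

/-- The head vertex of an oriented edge. -/
def h (G : OrientedGraph V E) : G.Dart → V
  | .inl e => G.head e
  | .inr e => G.tail e

/-- The tail vertex of an oriented edge. -/
def t (G : OrientedGraph V E) : G.Dart → V
  | .inl e => G.tail e
  | .inr e => G.head e

/-- No edge joins a vertex to itself. -/
def Loopless (G : OrientedGraph V E) : Prop := ∀ e : E, G.head e ≠ G.tail e

/-- The graph is nonempty and any two vertices are joined by a path. -/
def Connected (G : OrientedGraph V E) : Prop :=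
  (SimpleGraph.fromRel fun u v : V => ∃ e : E, G.tail e = u ∧ G.head e = v).Connected

end OrientedGraph

/-! ### The adjacency operator of a graph of bounded degree on `ℓ²` of the vertices -/

namespace SimpleGraph

variable {X : Type*} (T : SimpleGraph X) [T.LocallyFinite]

theorem sum_sq_norm_sum_neighbors_le {D : ℕ} (hD : ∀ x, T.degree x ≤ D)
    (f : lp (fun _ : X => ℂ) 2) (s : Finset X) :
    ∑ x ∈ s, ‖∑ u ∈ T.neighborFinset x, f u‖ ^ (2 : ENNReal).toReal
      ≤ ((D : ℝ) * ‖f‖) ^ (2 : ENNReal).toReal := by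
  classical
  have hsum : ∀ s : Finset X, ∑ x ∈ s, ‖f x‖ ^ 2 ≤ ‖f‖ ^ 2 := by
    intro s
    have := lp.sum_rpow_le_norm_rpow (p := 2) (by simp) f s
    simpa using this
  have key : ∑ x ∈ s, ‖∑ u ∈ T.neighborFinset x, f u‖ ^ 2 ≤ ((D : ℝ) * ‖f‖) ^ 2 := by
    calc ∑ x ∈ s, ‖∑ u ∈ T.neighborFinset x, f u‖ ^ 2
        ≤ ∑ x ∈ s, (D : ℝ) * ∑ u ∈ T.neighborFinset x, ‖f u‖ ^ 2 := by
          refine Finset.sum_le_sum fun x _ => ?_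
          calc ‖∑ u ∈ T.neighborFinset x, f u‖ ^ 2
              ≤ (∑ u ∈ T.neighborFinset x, ‖f u‖) ^ 2 := by
                gcongr
                exact norm_sum_le _ _
            _ ≤ ((T.neighborFinset x).card : ℝ) * ∑ u ∈ T.neighborFinset x, ‖f u‖ ^ 2 :=
                sq_sum_le_card_mul_sum_sq
            _ ≤ (D : ℝ) * ∑ u ∈ T.neighborFinset x, ‖f u‖ ^ 2 := by
                gcongr
                exact hD x
      _ = (D : ℝ) * ∑ x ∈ s, ∑ u ∈ T.neighborFinset x, ‖f u‖ ^ 2 := by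
          rw [Finset.mul_sum]
      _ = (D : ℝ) * ∑ u ∈ (s.biUnion fun x => T.neighborFinset x),
            ∑ x ∈ s with T.Adj x u, ‖f u‖ ^ 2 := by
          congr 1
          refine Finset.sum_comm' fun x u => ?_
          simp only [SimpleGraph.mem_neighborFinset, Finset.mem_filter, Finset.mem_biUnion]
          constructor
          · rintro ⟨hx, hu⟩
            exact ⟨⟨hx, hu⟩, x, hx, hu⟩
          · rintro ⟨⟨hx, hu⟩, -⟩
            exact ⟨hx, hu⟩
      _ ≤ (D : ℝ) * ∑ u ∈ (s.biUnion fun x => T.neighborFinset x), (D : ℝ) * ‖f u‖ ^ 2 := by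
          gcongr with u _
          rw [Finset.sum_const, nsmul_eq_mul]
          gcongr
          refine le_trans (Finset.card_le_card fun x hx => ?_) (hD u)
          simp only [Finset.mem_filter] at hx
          simpa using hx.2.symm
      _ ≤ (D : ℝ) * ((D : ℝ) * ‖f‖ ^ 2) := by
          rw [← Finset.mul_sum]
          gcongr
          exact hsum _
      _ = ((D : ℝ) * ‖f‖) ^ 2 := by ring
  simpa using key

/-- The adjacency operator `(A f) x = ∑_{u ~ x} f u` on `ℓ²` of the vertices, for a graph all of
whose degrees are at most `D`. -/
noncomputable def adjacencyOperator {D : ℕ} (hD : ∀ x, T.degree x ≤ D) :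
    lp (fun _ : X => ℂ) 2 →L[ℂ] lp (fun _ : X => ℂ) 2 :=
  LinearMap.mkContinuous
    { toFun := fun f => ⟨fun x => ∑ u ∈ T.neighborFinset x, f u,
        memℓp_gen' (T.sum_sq_norm_sum_neighbors_le hD f)⟩
      map_add' := fun f g => by
        ext x
        exact Finset.sum_add_distrib
      map_smul' := fun c f => by
        ext x
        simp [Finset.mul_sum] }
    D fun f => lp.norm_le_of_forall_sum_le (by simp) (by positivity)
      (T.sum_sq_norm_sum_neighbors_le hD f)

theorem adjacencyOperator_apply {D : ℕ} (hD : ∀ x, T.degree x ≤ D)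
    (f : lp (fun _ : X => ℂ) 2) (x : X) :
    T.adjacencyOperator hD f x = ∑ u ∈ T.neighborFinset x, f u := rfl

end SimpleGraph

/-! ### The universal covering tree and its spectral radius -/

namespace OrientedGraph

variable {V E : Type*}

/-- The non-backtracking walks of `G` that end at `v₀`, written as the lists of oriented edges they
traverse: consecutive edges are composable and not opposite to each other. The empty list is the
trivial walk. -/
def ReducedWalk (G : OrientedGraph V E) (v₀ : V) : Type _ :=
  {l : List G.Dart //
    l.IsChain (fun e e' => G.h e = G.t e' ∧ e' ≠ e.swap) ∧ ∀ e ∈ l.getLast?, G.h e = v₀}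

/-- The universal covering tree of a connected graph `G` with base vertex `v₀`. Its vertices are the
non-backtracking walks ending at `v₀`, and two of them are adjacent if one is obtained from the
other by adding one edge at the start. The covering map sends a walk to its starting vertex. -/
def universalCover (G : OrientedGraph V E) (v₀ : V) : SimpleGraph (G.ReducedWalk v₀) where
  Adj w w' := (∃ e, w'.1 = e :: w.1) ∨ ∃ e, w.1 = e :: w'.1
  symm := ⟨fun _ _ h => h.symm⟩
  loopless := ⟨fun w h => by
    rcases h with ⟨e, h⟩ | ⟨e, h⟩ <;> simpa using congrArg List.length h⟩

theorem universalCover_neighborSet_subset (G : OrientedGraph V E) (v₀ : V)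
    (w : G.ReducedWalk v₀) :
    Subtype.val '' (G.universalCover v₀).neighborSet w ⊆
      insert w.1.tail (Set.range fun e => e :: w.1) := by
  rintro _ ⟨w', h, rfl⟩
  rcases h with ⟨e, h⟩ | ⟨e, h⟩
  · exact Or.inr ⟨e, h.symm⟩
  · left
    rw [h, List.tail_cons]

theorem universalCover_neighborSet_finite [Finite E] (G : OrientedGraph V E) (v₀ : V)
    (w : G.ReducedWalk v₀) : ((G.universalCover v₀).neighborSet w).Finite :=
  Set.Finite.of_finite_image
    (((Set.finite_range _).insert _).subset (G.universalCover_neighborSet_subset v₀ w))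
    Subtype.val_injective.injOn

noncomputable instance [Finite E] (G : OrientedGraph V E) (v₀ : V) :
    (G.universalCover v₀).LocallyFinite :=
  fun w => (G.universalCover_neighborSet_finite v₀ w).fintype

theorem universalCover_degree_le [Finite E] (G : OrientedGraph V E) (v₀ : V)
    (w : G.ReducedWalk v₀) : (G.universalCover v₀).degree w ≤ Nat.card G.Dart + 1 := by
  have key : (Subtype.val '' (G.universalCover v₀).neighborSet w).ncard =
      ((G.universalCover v₀).neighborSet w).ncard :=
    Set.ncard_image_of_injective _ Subtype.val_injective
  rw [← SimpleGraph.card_neighborSet_eq_degree, ← Nat.card_eq_fintype_card,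
    Nat.card_coe_set_eq, ← key]
  refine (Set.ncard_le_ncard (G.universalCover_neighborSet_subset v₀ w)
    ((Set.finite_range _).insert _)).trans ((Set.ncard_insert_le _ _).trans ?_)
  gcongr
  rw [← Set.image_univ, ← Set.ncard_univ]
  exact Set.ncard_image_le Set.finite_univ

/-- `ρ(G)`, the spectral radius of the universal covering tree of `G` (with base vertex `v₀`), that
is, of its adjacency operator on `ℓ²`. For a connected graph it does not depend on `v₀`. -/
noncomputable def rho [Finite E] (G : OrientedGraph V E) (v₀ : V) : ℝ :=
  (spectralRadius ℂ
    ((G.universalCover v₀).adjacencyOperator (G.universalCover_degree_le v₀))).toReal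

/-! ### Labelings and coverings -/

/-- A `Γ`-labeling of `G`: a function `γ` on the oriented edges with `γ (-e) = (γ e)⁻¹`. -/
def Labeling (G : OrientedGraph V E) (Γ : Type*) [Group Γ] : Type _ :=
  {γ : G.Dart → Γ // ∀ e, γ e.swap = (γ e)⁻¹}

section Covering

variable [Fintype V] [DecidableEq V] [Fintype E] (G : OrientedGraph V E) {Γ : Type*} [Group Γ]
  {d : ℕ} (π : Γ →* GL (Fin d) ℂ)

/-- The `(Γ, π)`-covering matrix `A_{γ,π}`: its `(u, v)` block is the sum of the `d × d` matrices
`π (γ e)` over all oriented edges `e` from `u` to `v`. -/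
noncomputable def coveringMatrix (γ : G.Labeling Γ) : Matrix (V × Fin d) (V × Fin d) ℂ :=
  fun p q => ∑ e : G.Dart with G.t e = p.1 ∧ G.h e = q.1, (π (γ.1 e) : Matrix _ _ ℂ) p.2 q.2

/-- The spectrum of the `(Γ, π)`-covering, as a multiset. -/
noncomputable def coveringSpectrum (γ : G.Labeling Γ) : Multiset ℂ :=
  (G.coveringMatrix π γ).charpoly.roots

/-- The `(Γ, π)`-covering `A_{γ,π}` of the connected graph `G` is one-sided Ramanujan: all its
eigenvalues are real and at most `ρ(G)`. -/
def IsOneSidedRamanujan (γ : G.Labeling Γ) : Prop :=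
  ∀ μ ∈ G.coveringSpectrum π γ, μ.im = 0 ∧ ∀ v₀ : V, μ.re ≤ G.rho v₀

end Covering

end OrientedGraph

/-! ### The two properties of a representation -/

/-- The `m`-th exterior power of a representation. -/
noncomputable def Representation.exteriorPow {k Γ M : Type*} [CommRing k] [Monoid Γ]
    [AddCommGroup M] [Module k M] (ρ : Representation k Γ M) (m : ℕ) :
    Representation k Γ (⋀[k]^m M) where
  toFun g := exteriorPower.map m (ρ g)
  map_one' := by
    rw [map_one]
    exact exteriorPower.map_id
  map_mul' a b := by
    rw [map_mul]
    exact exteriorPower.map_comp (ρ b) (ρ a)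

/-- The action of `Γ` on `ℂ^d` through matrices. -/
noncomputable def matrixRep {Γ : Type*} [Group Γ] {d : ℕ} (π : Γ →* GL (Fin d) ℂ) :
    Representation ℂ Γ (Fin d → ℂ) where
  toFun g := Matrix.toLin' (π g : Matrix (Fin d) (Fin d) ℂ)
  map_one' := by
    rw [map_one, Units.val_one, Matrix.toLin'_one]
    rfl
  map_mul' a b := by
    rw [map_mul, Units.val_mul, Matrix.toLin'_mul]
    rfl

/-- Property (P1): the exterior powers `⋀^m π`, `0 ≤ m ≤ d`, are irreducible and pairwise
non-isomorphic. -/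
def PropertyP1 {Γ : Type*} [Group Γ] {d : ℕ} (π : Γ →* GL (Fin d) ℂ) : Prop :=
  (∀ m ≤ d, ((matrixRep π).exteriorPow m).IsIrreducible) ∧
    ∀ m ≤ d, ∀ m' ≤ d, m ≠ m' →
      IsEmpty (((matrixRep π).exteriorPow m).Equiv ((matrixRep π).exteriorPow m'))

/-- A pseudo-reflection is an invertible matrix `A` of finite order with `rank (A - I) = 1`. -/
def IsPseudoReflection {d : ℕ} (A : GL (Fin d) ℂ) : Prop :=
  IsOfFinOrder A ∧ ((A : Matrix (Fin d) (Fin d) ℂ) - 1).rank = 1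

/-- Property (P2): the group `π(Γ)` is generated by pseudo-reflections. -/
def PropertyP2 {Γ : Type*} [Group Γ] {d : ℕ} (π : Γ →* GL (Fin d) ℂ) : Prop :=
  ∃ S : Set (GL (Fin d) ℂ), (∀ A ∈ S, IsPseudoReflection A) ∧ Subgroup.closure S = π.range

/-! Label the edges independently and uniformly. The proof has two halves: the average of det(x -
A_γ) over all labelings is positive for x > ρ(G), and some single labeling has largest eigenvalue at
most the largest root of that average.

The average. By (P1) and Schur's lemma, averaging over Γ a product of a matrix coefficient of Λ^k
π(g) and one of Λ^l π(g⁻¹) gives a value that depends on d only, not on Γ: every "mixing" family of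
matrices gives the same one (`IsMixing.average_eq`). As a function of the two blocks of one edge,
det(x - A_γ) is a combination of such products (`det_add_place_mem_coeffSpan`), so Γ can be replaced
edge by edge by the group of signed permutation matrices (`IsMixing.pi_average_eq`). A signed
permutation labeling is a permutation d-cover of G with a signing, and averaging over signs turns
the characteristic polynomial into the matching polynomial of the cover (Godsil and Gutman; here
`signedSum`). Finally, all these matching polynomials are positive above ρ(G): the Green function of
the universal cover at some y with ρ(G) < y < x is a positive supersolution, and induction on vertex
sets with the matching recurrence compares ratios of matching polynomials with ratios of its values
(`signedSum_pos`).

The choice. Make π unitary, so that A_γ is a hermitian sum of edge matrices. Multiplying one label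
by a pseudo-reflection is a congruence by 1 + a bᴴ, which alters A_γ by a difference of two positive
rank one matrices. Hence the two characteristic polynomials have a common interlacer: if both have a
root above l, so does their average. The structure `IsInterlacing` survives this averaging, so it
can be iterated: if every labeling has a root above l, so does every average over lazy random
products of pseudo-reflections. By (P2) these products equidistribute in Γ^E, so the lazy averages
approach the uniform average, which is bounded away from zero on compact intervals above ρ(G). This
contradiction is `exists_forall_eval_ne_zero`. -/

set_option linter.unusedSectionVars false

/-! ### Moving along darts in the universal covering tree -/

namespace OrientedGraph

variable {V E : Type*}

/-- The vertex of `G` over which a reduced walk lies: its starting vertex. -/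
def ReducedWalk.start {G : OrientedGraph V E} {v₀ : V} (w : G.ReducedWalk v₀) : V :=
  (w.1.head?.map G.t).getD v₀

open Classical in
/-- Move a walk along the dart `δ`, whose head is the start of the walk: prepend `δ`, and cancel it
if it is opposite to the first dart of the walk. -/
noncomputable def ReducedWalk.step {G : OrientedGraph V E} {v₀ : V} (w : G.ReducedWalk v₀)
    (δ : G.Dart) : G.ReducedWalk v₀ :=
  if h1 : w.1.head? = some δ.swap then
    ⟨w.1.tail, w.2.1.tail, fun e he => w.2.2 e (by
      rcases hw : w.1 with _ | ⟨a, _ | ⟨b, l⟩⟩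
      · simp [hw] at he
      · simp [hw] at he
      · simpa [hw] using he)⟩
  else if h : G.h δ = w.start then
    ⟨δ :: w.1, by
      rcases w with ⟨_ | ⟨a, l⟩, hw⟩
      · simpa [ReducedWalk.start] using h
      · exact ⟨List.isChain_cons_cons.2 ⟨⟨by simpa [ReducedWalk.start] using h,
          by simpa using h1⟩, hw.1⟩, by simpa using hw.2⟩⟩
  -- Junk value, for darts that do not end at the start of the walk. In the cancelling case above,
  -- the dart does end there automatically.
  else w

theorem ReducedWalk.step_spec {G : OrientedGraph V E} {v₀ : V} (w : G.ReducedWalk v₀)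
    (δ : G.Dart) (h : G.h δ = w.start) :
    (w.step δ).1 = δ :: w.1 ∧ w.1.head? ≠ some δ.swap ∨ w.1 = δ.swap :: (w.step δ).1 := by
  classical
  by_cases h1 : w.1.head? = some δ.swap
  · right
    have h2 : w.step δ = ⟨w.1.tail, _⟩ := dif_pos h1
    rw [h2]
    exact (List.cons_head?_tail h1).symm
  · have h2 : w.step δ = ⟨δ :: w.1, _⟩ := (dif_neg h1).trans (dif_pos h)
    exact Or.inl ⟨by rw [h2], h1⟩

theorem h_swap (G : OrientedGraph V E) (δ : G.Dart) : G.h δ.swap = G.t δ := by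
  cases δ <;> rfl

theorem t_swap (G : OrientedGraph V E) (δ : G.Dart) : G.t δ.swap = G.h δ := by
  cases δ <;> rfl

theorem ReducedWalk.start_step {G : OrientedGraph V E} {v₀ : V} (w : G.ReducedWalk v₀)
    (δ : G.Dart) (h : G.h δ = w.start) : (w.step δ).start = G.t δ := by
  rcases w.step_spec δ h with ⟨h1, -⟩ | h1
  · simp [start, h1]
  · rcases hl : (w.step δ).1 with _ | ⟨a, l⟩
    · have := w.2.2 δ.swap (by simp [h1, hl])
      simp [start, hl, ← this, h_swap]
    · have := w.2.1
      rw [h1, hl, List.isChain_cons_cons] at this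
      simp [start, hl, ← this.1.1, h_swap]

theorem ReducedWalk.step_step_swap {G : OrientedGraph V E} {v₀ : V} (w : G.ReducedWalk v₀)
    (δ : G.Dart) (h : G.h δ = w.start) : (w.step δ).step δ.swap = w := by
  have h' : G.h δ.swap = (w.step δ).start := by rw [w.start_step δ h, h_swap]
  apply Subtype.ext
  rcases w.step_spec δ h with ⟨h1, -⟩ | h1 <;>
  rcases (w.step δ).step_spec δ.swap h' with ⟨h2, h3⟩ | h2
  · simp [h1] at h3
  · simpa [h1] using h2.symm
  · rw [h2, ← h1]
  -- Cancelling twice would mean that `w` begins with `δ.swap, δ`, a backtrack.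
  · have := w.2.1
    rw [h1, h2, List.isChain_cons_cons] at this
    simp at this

theorem ReducedWalk.adj_step {G : OrientedGraph V E} {v₀ : V} (w : G.ReducedWalk v₀)
    (δ : G.Dart) (h : G.h δ = w.start) : (G.universalCover v₀).Adj w (w.step δ) := by
  rcases w.step_spec δ h with ⟨h1, -⟩ | h1
  · exact Or.inl ⟨_, h1⟩
  · exact Or.inr ⟨_, h1⟩

/-- A lengthened walk and a shortened one have different lengths; otherwise the dart can be read off
the longer walk. Thus parallel edges lead to different neighbours in the tree, and a sum over darts
is at most the sum over neighbours. -/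
theorem ReducedWalk.step_injOn {G : OrientedGraph V E} {v₀ : V} (w : G.ReducedWalk v₀) :
    Set.InjOn w.step {δ | G.h δ = w.start} := by
  intro δ hδ δ' hδ' heq
  have heq' := congrArg Subtype.val heq
  rcases w.step_spec δ hδ with ⟨h1, -⟩ | h1 <;>
  rcases w.step_spec δ' hδ' with ⟨h2, h3⟩ | h2
  · rw [h1, h2] at heq'
    exact (List.cons.inj heq').1
  · rw [← heq', h1] at h2
    exact absurd (congrArg List.length h2) (by simp; omega)
  · rw [heq', h2] at h1
    exact absurd (congrArg List.length h1) (by simp; omega)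
  · rw [h1, heq'] at h2
    exact Sum.swap_leftInverse.injective (List.cons.inj h2).1

/-- The trivial walk. -/
def ReducedWalk.nil (G : OrientedGraph V E) (v₀ : V) : G.ReducedWalk v₀ := ⟨[], by simp⟩

/-- A path of `G` from `v` to `v₀` lifts to the tree dart by dart. -/
theorem ReducedWalk.start_surjective {G : OrientedGraph V E} (hG : G.Connected) (v₀ : V) :
    Function.Surjective (ReducedWalk.start (G := G) (v₀ := v₀)) := by
  intro v
  obtain ⟨p⟩ := hG.preconnected v v₀
  induction p with
  | nil => exact ⟨nil G _, rfl⟩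
  | cons hadj p ih =>
    obtain ⟨w, hw⟩ := ih
    rw [SimpleGraph.fromRel_adj] at hadj
    rcases hadj.2 with ⟨e, h1, h2⟩ | ⟨e, h1, h2⟩
    · exact ⟨w.step (.inl e), by rw [start_step _ _ (by rw [hw]; exact h2)]; exact h1⟩
    · exact ⟨w.step (.inr e), by rw [start_step _ _ (by rw [hw]; exact h1)]; exact h2⟩

end OrientedGraph

/-! ### Positive supersolutions above the spectral radius -/

open Filter Topology in
/-- Powers of an operator grow at most exponentially, with any rate above its spectral radius. -/
theorem eventually_norm_pow_le_of_spectralRadius_lt {A : Type*} [NormedRing A] [NormedAlgebra ℂ A]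
    [CompleteSpace A] (a : A) {r : ℝ} (hr : (spectralRadius ℂ a).toReal < r)
    (hfin : spectralRadius ℂ a ≠ ⊤) :
    ∀ᶠ n : ℕ in atTop, ‖a ^ n‖ ≤ r ^ n := by
  have hr0 : 0 < r := ENNReal.toReal_nonneg.trans_lt hr
  have hlt : spectralRadius ℂ a < ENNReal.ofReal r :=
    (ENNReal.lt_ofReal_iff_toReal_lt hfin).2 hr
  filter_upwards [(spectrum.pow_norm_pow_one_div_tendsto_nhds_spectralRadius a).eventually_lt_const
    hlt, eventually_gt_atTop 0] with n hn hn0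
  rw [ENNReal.ofReal_lt_ofReal_iff hr0] at hn
  calc ‖a ^ n‖ = (‖a ^ n‖ ^ (1 / n : ℝ)) ^ n := by
        rw [← Real.rpow_natCast, ← Real.rpow_mul (norm_nonneg _), one_div,
          inv_mul_cancel₀ (by positivity), Real.rpow_one]
    _ ≤ r ^ n := by gcongr

namespace SimpleGraph

variable {X : Type*} (T : SimpleGraph X) [T.LocallyFinite]

open Classical in
/-- The number of walks of length `k` in `T` from `x` to `o`. -/
noncomputable def walkCount (o : X) : ℕ → X → ℝ
  | 0, x => if x = o then 1 else 0
  | k + 1, x => ∑ u ∈ T.neighborFinset x, walkCount o k u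

theorem walkCount_nonneg (o : X) (k : ℕ) (x : X) : 0 ≤ T.walkCount o k x := by
  induction k generalizing x with
  | zero => unfold walkCount; split_ifs <;> norm_num
  | succ k ih => exact Finset.sum_nonneg fun u _ => ih u

/-- The walk count is the coordinate at `x` of the `k`-th power of the operator applied to the unit
vector at `o`. -/
theorem walkCount_le_norm {D : ℕ} (hD : ∀ x, T.degree x ≤ D) (o : X) (k : ℕ) (x : X) :
    T.walkCount o k x ≤ ‖T.adjacencyOperator hD ^ k‖ := by
  classical
  have key : ∀ k x, (T.adjacencyOperator hD ^ k) (lp.single 2 o (1 : ℂ)) x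
      = (T.walkCount o k x : ℂ) := by
    intro k
    induction k with
    | zero =>
      intro x
      simp [walkCount, lp.single_apply, Pi.single_apply, apply_ite]
    | succ k ih =>
      intro x
      rw [pow_succ']
      change T.adjacencyOperator hD ((T.adjacencyOperator hD ^ k) _) x = _
      rw [adjacencyOperator_apply, walkCount]
      rw [Complex.ofReal_sum]
      exact Finset.sum_congr rfl fun u _ => ih u
  calc T.walkCount o k x = ‖(T.walkCount o k x : ℂ)‖ := by
        rw [Complex.norm_real, Real.norm_of_nonneg (T.walkCount_nonneg o k x)]
    _ = ‖(T.adjacencyOperator hD ^ k) (lp.single 2 o (1 : ℂ)) x‖ := by rw [key]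
    _ ≤ ‖(T.adjacencyOperator hD ^ k) (lp.single 2 o (1 : ℂ))‖ := lp.norm_apply_le_norm (by simp) _ _
    _ ≤ ‖T.adjacencyOperator hD ^ k‖ * ‖lp.single (E := fun _ : X => ℂ) 2 o (1 : ℂ)‖ :=
        ContinuousLinearMap.le_opNorm _ _
    _ = ‖T.adjacencyOperator hD ^ k‖ := by
        rw [lp.norm_single (by simp)]; simp

theorem spectralRadius_adjacencyOperator_ne_top {D : ℕ} (hD : ∀ x, T.degree x ≤ D) :
    spectralRadius ℂ (T.adjacencyOperator hD) ≠ ⊤ := by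
  refine ne_top_of_le_ne_top ?_ (spectrum.spectralRadius_le_pow_nnnorm_pow_one_div ℂ
    (T.adjacencyOperator hD) 0)
  simp [ENNReal.mul_eq_top]

/-- Above the spectral radius, the adjacency operator has a nonnegative supersolution, positive
at every vertex that is reached by walks from `o`. -/
theorem exists_supersolution {D : ℕ} (hD : ∀ x, T.degree x ≤ D) (o : X) {y : ℝ}
    (hy : (spectralRadius ℂ (T.adjacencyOperator hD)).toReal < y)
    (hreach : ∀ x, ∃ k, 0 < T.walkCount o k x) :
    ∃ g : X → ℝ, (∀ x, 0 < g x) ∧ ∀ x, ∑ u ∈ T.neighborFinset x, g u ≤ y * g x := by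
  obtain ⟨r, hr1, hr2⟩ := exists_between hy
  have hr0 : 0 < r := ENNReal.toReal_nonneg.trans_lt hr1
  have hy0 : 0 < y := hr0.trans hr2
  have hsum : ∀ x, Summable fun k => T.walkCount o k x / y ^ k := by
    intro x
    refine summable_of_isBigO_nat (g := fun k : ℕ => (r / y) ^ k)
      (summable_geometric_of_lt_one (by positivity) ((div_lt_one hy0).2 hr2)) ?_
    refine Asymptotics.IsBigO.of_bound 1 ?_
    filter_upwards [eventually_norm_pow_le_of_spectralRadius_lt _ hr1
      (T.spectralRadius_adjacencyOperator_ne_top hD)] with k hk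
    rw [one_mul, Real.norm_of_nonneg (div_nonneg (T.walkCount_nonneg _ _ _) (by positivity)),
      Real.norm_of_nonneg (by positivity), div_pow]
    gcongr
    exact (T.walkCount_le_norm hD o k x).trans hk
  -- The Green function: up to the factor `y`, the resolvent at `y` applied to the unit vector at
  -- `o`. The inequality is an equality except at `o`, where the walk of length zero is lost.
  refine ⟨fun x => ∑' k, T.walkCount o k x / y ^ k, fun x => ?_, fun x => ?_⟩
  · obtain ⟨k, hk⟩ := hreach x
    exact (hsum x).tsum_pos (fun k => div_nonneg (T.walkCount_nonneg _ _ _) (by positivity)) k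
      (by positivity)
  · beta_reduce
    rw [← Summable.tsum_finsetSum fun u _ => hsum u, (hsum x).tsum_eq_zero_add, mul_add,
      ← tsum_mul_left]
    have : ∀ k, y * (T.walkCount o (k + 1) x / y ^ (k + 1)) =
        ∑ u ∈ T.neighborFinset x, T.walkCount o k u / y ^ k := by
      intro k
      rw [walkCount, ← Finset.sum_div, pow_succ]
      field_simp
    simp_rw [this]
    have h0 := T.walkCount_nonneg o 0 x
    have : 0 ≤ y * (T.walkCount o 0 x / y ^ 0) := by positivity
    linarith

end SimpleGraph

namespace OrientedGraph

variable {V E : Type*}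

/-- Deleting the first dart again and again leads to the trivial walk. This makes the Green function
positive everywhere. -/
theorem walkCount_pos [Finite E] (G : OrientedGraph V E) (v₀ : V) (w : G.ReducedWalk v₀) :
    ∃ k, 0 < (G.universalCover v₀).walkCount (ReducedWalk.nil G v₀) k w := by
  obtain ⟨n, hn⟩ : ∃ n, w.1.length = n := ⟨_, rfl⟩
  induction n generalizing w with
  | zero =>
    have : w = ReducedWalk.nil G v₀ := Subtype.ext (List.length_eq_zero_iff.1 hn)
    exact ⟨0, by rw [this, SimpleGraph.walkCount, if_pos rfl]; exact one_pos⟩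
  | succ n ih =>
    obtain ⟨e, l, hel⟩ := List.exists_cons_of_length_eq_add_one hn
    have hl := w.2
    rw [hel] at hl
    have hl' : l.IsChain (fun e e' => G.h e = G.t e' ∧ e' ≠ e.swap) ∧
        ∀ e ∈ l.getLast?, G.h e = v₀ := by
      refine ⟨hl.1.tail, fun e' he' => hl.2 e' ?_⟩
      rcases l with _ | ⟨a, l⟩
      · simp at he'
      · simpa using he'
    obtain ⟨k, hk⟩ := ih ⟨l, hl'⟩ (by simpa [hel] using hn)
    refine ⟨k + 1, hk.trans_le ?_⟩
    refine Finset.single_le_sum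
      (f := fun u => (G.universalCover v₀).walkCount (ReducedWalk.nil G v₀) k u)
      (fun u _ => SimpleGraph.walkCount_nonneg _ _ _ _) ?_
    exact (SimpleGraph.mem_neighborFinset _ _ _).2 (Or.inr ⟨e, hel⟩)

/-- A positive supersolution on the universal cover, expressed through the darts of `G`. -/
theorem exists_supersolution [Fintype V] [DecidableEq V] [Fintype E] (G : OrientedGraph V E)
    (v₀ : V) {y : ℝ} (hy : G.rho v₀ < y) :
    ∃ g : G.ReducedWalk v₀ → ℝ, (∀ w, 0 < g w) ∧
      ∀ w, ∑ δ : G.Dart with G.h δ = w.start, g (w.step δ) ≤ y * g w := by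
  classical
  obtain ⟨g, hg, hsup⟩ := (G.universalCover v₀).exists_supersolution
    (G.universalCover_degree_le v₀) (ReducedWalk.nil G v₀) hy (G.walkCount_pos v₀)
  refine ⟨g, hg, fun w => le_trans ?_ (hsup w)⟩
  rw [← Finset.sum_image (f := g) (s := {δ : G.Dart | G.h δ = w.start}) (g := w.step)]
  · refine Finset.sum_le_sum_of_subset_of_nonneg ?_ fun _ _ _ => (hg _).le
    intro u hu
    obtain ⟨δ, hδ, rfl⟩ := Finset.mem_image.1 hu
    rw [SimpleGraph.mem_neighborFinset]
    exact w.adj_step δ (by simpa using hδ)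
  · simpa using w.step_injOn

end OrientedGraph

theorem sum_mul_left_eq_sum {𝒢 M : Type*} [Group 𝒢] [Fintype 𝒢] [AddCommMonoid M] (a : 𝒢)
    (f : 𝒢 → M) : ∑ g, f (a * g) = ∑ g, f g :=
  Equiv.sum_comp (Equiv.mulLeft a) f

/-! ### Principal minors and the effect of one signed edge -/

namespace Matrix

variable {N R : Type*} [Fintype N] [DecidableEq N] [CommRing R]

/-- The matrix that agrees with `M` on `W × W` and with the identity matrix elsewhere; its
determinant is the principal minor of `M` on `W`. -/
def mask (W : Finset N) (M : Matrix N N R) : Matrix N N R :=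
  fun i j => if i ∈ W ∧ j ∈ W then M i j else (1 : Matrix N N R) i j

/-- Both sides are the diagonal entry of the adjugate at `a`, which transposition preserves. -/
theorem det_updateRow_single_self_eq_updateCol (M : Matrix N N R) (a : N) :
    (M.updateRow a (Pi.single a 1)).det = (M.updateCol a (Pi.single a 1)).det := by
  rw [← det_transpose (M.updateCol _ _), ← updateRow_transpose, ← adjugate_apply,
    ← adjugate_apply, ← adjugate_transpose, transpose_apply]

theorem det_updateCol_updateRow_single_self (M : Matrix N N R) (a : N) :
    ((M.updateRow a (Pi.single a 1)).updateCol a (Pi.single a 1)).det =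
      (M.updateRow a (Pi.single a 1)).det := by
  rw [← det_updateRow_single_self_eq_updateCol, updateRow_idem]

theorem det_updateRow_mask_single (W : Finset N) (M : Matrix N N R) (a : N) :
    ((mask W M).updateRow a (Pi.single a 1)).det = (mask (W.erase a) M).det := by
  rw [← det_updateCol_updateRow_single_self]
  congr 1
  ext i j
  by_cases hi : i = a <;> by_cases hj : j = a <;>
    simp [updateRow_apply, mask, hi, hj, one_apply, Ne.symm]

theorem det_updateRow_updateRow_mask_single (W : Finset N) (M : Matrix N N R) {a b : N}
    (hab : a ≠ b) :
    (((mask W M).updateRow b (Pi.single b 1)).updateRow a (Pi.single a 1)).det =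
      (mask ((W.erase a).erase b) M).det := by
  rw [← det_updateCol_updateRow_single_self, ← det_updateRow_mask_single]
  congr 1
  ext i j
  by_cases hi : i = a <;> by_cases hj : j = a <;> by_cases hi' : i = b <;> by_cases hj' : j = b <;>
    simp_all [updateCol_apply, updateRow_apply, mask, one_apply, Pi.single_apply, eq_comm]

theorem mask_add_of_mem {W : Finset N} {a b : N} (ha : a ∈ W) (hb : b ∈ W) (M : Matrix N N R)
    (t : R) :
    mask W (M + t • (single a b 1 + single b a 1)) =
      mask W M + t • (single a b 1 + single b a 1) := by
  ext i j
  by_cases h : i ∈ W ∧ j ∈ W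
  · simp [mask, h]
  · have h1 : ¬ (a = i ∧ b = j) := by rintro ⟨rfl, rfl⟩; exact h ⟨ha, hb⟩
    have h2 : ¬ (b = i ∧ a = j) := by rintro ⟨rfl, rfl⟩; exact h ⟨hb, ha⟩
    simp [mask, h, h1, h2]

theorem mask_add_of_not_mem {W : Finset N} {a b : N} (hab : ¬ (a ∈ W ∧ b ∈ W))
    (M : Matrix N N R) (t : R) :
    mask W (M + t • (single a b 1 + single b a 1)) = mask W M := by
  ext i j
  by_cases h : i ∈ W ∧ j ∈ W
  · have h1 : ¬ (a = i ∧ b = j) := by rintro ⟨rfl, rfl⟩; exact hab h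
    have h2 : ¬ (b = i ∧ a = j) := by rintro ⟨rfl, rfl⟩; exact hab h.symm
    simp [mask, h, h1, h2]
  · simp [mask, h]

/-- Multilinearity in the rows `a` and `b`. In the quadratic term these rows are two unit vectors in
the wrong order, whence the minus sign. -/
theorem det_add_smul_single_add_single (M : Matrix N N R) {a b : N} (hab : a ≠ b) (t : R) :
    (M + t • (single a b 1 + single b a 1)).det =
      M.det + t * (M.updateRow a (Pi.single b 1)).det + t * (M.updateRow b (Pi.single a 1)).det
        - t ^ 2 * ((M.updateRow b (Pi.single b 1)).updateRow a (Pi.single a 1)).det := by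
  have h : M + t • (single a b 1 + single b a 1) =
      (M.updateRow b (M b + t • Pi.single a 1)).updateRow a (M a + t • Pi.single b 1) := by
    ext i j
    by_cases hi : i = a
    · subst hi
      simp [single_apply, Pi.single_apply, hab.symm, eq_comm]
    · by_cases hi' : i = b
      · subst hi'
        simp [single_apply, Pi.single_apply, updateRow_apply, hab, hab.symm, eq_comm]
      · simp [updateRow_apply, hi, hi', Ne.symm hi, Ne.symm hi']
  have hswap : ((M.updateRow b (Pi.single a 1)).updateRow a (Pi.single b 1)).det =
      - ((M.updateRow b (Pi.single b 1)).updateRow a (Pi.single a 1)).det := by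
    rw [← neg_one_mul]
    have := det_permute (Equiv.swap a b)
      ((M.updateRow b (Pi.single b 1)).updateRow a (Pi.single a 1))
    rw [Equiv.Perm.sign_swap hab] at this
    simp only [Units.val_neg, Units.val_one, Int.cast_neg, Int.cast_one] at this
    rw [← this]
    congr 1
    ext i j
    by_cases hi : i = a
    · subst hi
      simp [updateRow_apply, hab.symm]
    · by_cases hi' : i = b
      · subst hi'
        simp [updateRow_apply, hab.symm]
      · simp [updateRow_apply, hi, hi', Equiv.swap_apply_of_ne_of_ne hi hi']
  have h1 : (M.updateRow b (M b + t • Pi.single a 1)).updateRow a (M a) =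
      M.updateRow b (M b + t • Pi.single a 1) := by
    conv_rhs => rw [← updateRow_eq_self (M.updateRow b (M b + t • Pi.single a 1)) a]
    rw [updateRow_ne hab]
  have h2 : ∀ w, (M.updateRow b (M b)).updateRow a w = M.updateRow a w := by
    intro w
    rw [updateRow_eq_self]
  have hcomm : ∀ w w', (M.updateRow b w).updateRow a w' = (M.updateRow a w').updateRow b w := by
    intro w w'
    exact updateRow_comm _ hab.symm _ _
  rw [h, det_updateRow_add, det_updateRow_smul, h1, det_updateRow_add, det_updateRow_smul,
    updateRow_eq_self, hcomm, det_updateRow_add, det_updateRow_smul, ← hcomm, ← hcomm, h2, hswap]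
  ring

/-- The Godsil–Gutman step: the terms linear in `t` cancel between the two signs, and the quadratic
one, the minor without both endpoints, counts the matchings that use the edge. -/
theorem det_mask_add_add_det_mask_sub {W : Finset N} {a b : N} (ha : a ∈ W) (hb : b ∈ W)
    (hab : a ≠ b) (M : Matrix N N R) {t : R} (ht : t ^ 2 = 1) :
    (mask W (M + t • (single a b 1 + single b a 1))).det +
      (mask W (M + (-t) • (single a b 1 + single b a 1))).det =
      2 * ((mask W M).det - (mask ((W.erase a).erase b) M).det) := by
  rw [mask_add_of_mem ha hb, mask_add_of_mem ha hb, det_add_smul_single_add_single _ hab,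
    det_add_smul_single_add_single _ hab, det_updateRow_updateRow_mask_single _ _ hab, neg_sq, ht]
  ring

end Matrix

/-! ### Matching polynomials and their positivity -/

namespace OrientedGraph

open Matrix

variable {N F : Type*} [Fintype N] [DecidableEq N] [Fintype F] [DecidableEq F]

/-- The signed matrix `x - A` on the subgraph with edge set `S`. -/
def signedMatrix (H : OrientedGraph N F) (x : ℝ) (S : Finset F) (ε : F → ℤˣ) : Matrix N N ℝ :=
  x • 1 - ∑ e ∈ S, ((ε e : ℤ) : ℝ) • (single (H.tail e) (H.head e) 1 + single (H.head e) (H.tail e) 1)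

/-- The sum over all signings of the principal minors of `x - A` on `W`: up to the factor
`2 ^ |F|` this is the matching polynomial of the subgraph with vertices `W` and edges `S`. -/
noncomputable def signedSum (H : OrientedGraph N F) (x : ℝ) (W : Finset N) (S : Finset F) : ℝ :=
  ∑ ε : F → ℤˣ, (mask W (H.signedMatrix x S ε)).det

theorem signedMatrix_insert (H : OrientedGraph N F) (x : ℝ) {S : Finset F} {e : F} (he : e ∉ S)
    (ε : F → ℤˣ) : H.signedMatrix x (insert e S) ε = H.signedMatrix x S ε +
      (-((ε e : ℤ) : ℝ)) • (single (H.tail e) (H.head e) 1 + single (H.head e) (H.tail e) 1) := by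
  rw [signedMatrix, signedMatrix, Finset.sum_insert he, neg_smul]
  abel

theorem signedSum_insert_of_not_mem (H : OrientedGraph N F) (x : ℝ) {W : Finset N} {S : Finset F}
    {e : F} (he : e ∉ S) (h : ¬ (H.tail e ∈ W ∧ H.head e ∈ W)) :
    H.signedSum x W (insert e S) = H.signedSum x W S := by
  refine Finset.sum_congr rfl fun ε _ => ?_
  rw [signedMatrix_insert _ _ he, mask_add_of_not_mem h]

/-- The edge recurrence of the matching polynomial, obtained by pairing each signing with the one
that differs from it exactly at `e`. -/
theorem signedSum_insert (H : OrientedGraph N F) (hH : H.Loopless) (x : ℝ) {W : Finset N}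
    {S : Finset F} {e : F} (he : e ∉ S) (ht : H.tail e ∈ W) (hh : H.head e ∈ W) :
    H.signedSum x W (insert e S) =
      H.signedSum x W S - H.signedSum x ((W.erase (H.tail e)).erase (H.head e)) S := by
  obtain ⟨a, hae, ha⟩ : ∃ a : F → ℤˣ, a e = -1 ∧ ∀ e' ≠ e, a e' = 1 :=
    ⟨Pi.mulSingle e (-1), Pi.mulSingle_eq_same _ _, fun e' h => Pi.mulSingle_eq_of_ne h _⟩
  have hflip : ∑ ε : F → ℤˣ, (mask W (H.signedMatrix x (insert e S) ε)).det =
      ∑ ε : F → ℤˣ, (mask W (H.signedMatrix x (insert e S) (a * ε))).det :=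
    (sum_mul_left_eq_sum a
      fun ε => (mask W (H.signedMatrix x (insert e S) ε)).det).symm
  have hS : ∀ ε, H.signedMatrix x S (a * ε) = H.signedMatrix x S ε := by
    intro ε
    rw [signedMatrix, signedMatrix]
    congr 1
    refine Finset.sum_congr rfl fun e' he' => ?_
    have : e' ≠ e := fun h => he (h ▸ he')
    simp [ha _ this]
  have key : H.signedSum x W (insert e S) + H.signedSum x W (insert e S) =
      2 * (H.signedSum x W S - H.signedSum x ((W.erase (H.tail e)).erase (H.head e)) S) := by
    unfold signedSum
    nth_rewrite 2 [hflip]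
    rw [← Finset.sum_add_distrib, ← Finset.sum_sub_distrib, Finset.mul_sum]
    refine Finset.sum_congr rfl fun ε _ => ?_
    have hneg : (((a * ε) e : ℤ) : ℝ) = -((ε e : ℤ) : ℝ) := by
      rw [Pi.mul_apply, hae]
      simp
    have hsq : (-((ε e : ℤ) : ℝ)) ^ 2 = 1 := by
      rcases Int.units_eq_one_or (ε e) with h | h <;> simp [h]
    rw [signedMatrix_insert _ _ he, signedMatrix_insert _ _ he, hS, hneg]
    exact det_mask_add_add_det_mask_sub ht hh (hH e).symm (H.signedMatrix x S ε) hsq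
  linarith

theorem signedSum_empty (H : OrientedGraph N F) (x : ℝ) (S : Finset F) :
    H.signedSum x ∅ S = Fintype.card (F → ℤˣ) := by
  have : ∀ M : Matrix N N ℝ, mask ∅ M = 1 := fun M => by ext i j; simp [mask]
  simp [signedSum, this]

theorem signedSum_of_isolated (H : OrientedGraph N F) (x : ℝ) {W : Finset N} {S : Finset F} {v : N}
    (hv : v ∈ W) (hS : ∀ e ∈ S, H.tail e ≠ v ∧ H.head e ≠ v) :
    H.signedSum x W S = x * H.signedSum x (W.erase v) S := by
  unfold signedSum
  rw [Finset.mul_sum]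
  refine Finset.sum_congr rfl fun ε _ => ?_
  rw [← det_updateRow_mask_single, ← det_updateRow_smul]
  congr 1
  ext i j
  by_cases hi : i = v
  · subst hi
    have : H.signedMatrix x S ε i j = x * (1 : Matrix N N ℝ) i j := by
      rw [signedMatrix, Matrix.sub_apply, Matrix.smul_apply, smul_eq_mul, sub_eq_self, Matrix.sum_apply]
      refine Finset.sum_eq_zero fun e he => ?_
      simp [hS e he]
    by_cases hj : j = i
    · subst hj
      simp [mask, this, hv]
    · simp [mask, this, hj, Ne.symm hj]
  · simp [updateRow_apply, hi]

theorem signedSum_union_of_not_mem (H : OrientedGraph N F) (x : ℝ) {W : Finset N} {S : Finset F}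
    {v : N} (hv : v ∉ W) (T : Finset F) (hST : Disjoint T S)
    (hT : ∀ e ∈ T, H.tail e = v ∨ H.head e = v) :
    H.signedSum x W (T ∪ S) = H.signedSum x W S := by
  induction T using Finset.induction_on with
  | empty => simp
  | insert e T he ih =>
    rw [Finset.disjoint_insert_left] at hST
    rw [Finset.insert_union, signedSum_insert_of_not_mem, ih hST.2]
    · exact fun e' he' => hT e' (Finset.mem_insert_of_mem he')
    · simp [he, hST.1]
    · rintro ⟨h1, h2⟩
      rcases hT e (Finset.mem_insert_self _ _) with h | h
      · exact hv (h ▸ h1)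
      · exact hv (h ▸ h2)

/-- The contribution of the edge `e` to the recurrence at the vertex `v`. -/
noncomputable def edgeTerm (H : OrientedGraph N F) (x : ℝ) (W : Finset N) (S : Finset F) (v : N)
    (e : F) : ℝ :=
  (if H.head e = v ∧ H.tail e ∈ W then H.signedSum x ((W.erase v).erase (H.tail e)) S else 0) +
  (if H.tail e = v ∧ H.head e ∈ W then H.signedSum x ((W.erase v).erase (H.head e)) S else 0)

/-- The edges at `v` are inserted one by one. The term of an edge has `v` removed, so the edges
inserted before do not affect it: a matching uses at most one edge at `v`. -/
theorem signedSum_union (H : OrientedGraph N F) (hH : H.Loopless) (x : ℝ) {W : Finset N}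
    {S : Finset F} {v : N} (hv : v ∈ W) (T : Finset F) (hST : Disjoint T S)
    (hT : ∀ e ∈ T, H.tail e = v ∨ H.head e = v) :
    H.signedSum x W (T ∪ S) = H.signedSum x W S - ∑ e ∈ T, H.edgeTerm x W S v e := by
  induction T using Finset.induction_on with
  | empty => simp
  | insert e T he ih =>
    have hT' : ∀ e ∈ T, H.tail e = v ∨ H.head e = v :=
      fun e' he' => hT e' (Finset.mem_insert_of_mem he')
    rw [Finset.disjoint_insert_left] at hST
    have he' : e ∉ T ∪ S := by simp [he, hST.1]
    rw [Finset.insert_union, Finset.sum_insert he, edgeTerm]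
    rcases hT e (Finset.mem_insert_self _ _) with h | h
    · have hne : H.head e ≠ v := h ▸ hH e
      by_cases hw : H.head e ∈ W
      · rw [signedSum_insert H hH x he' (h ▸ hv) hw, ih hST.2 hT',
          signedSum_union_of_not_mem H x (v := v) (by simp [h]) T hST.2 hT']
        simp [h, hne, hw]
        ring
      · rw [signedSum_insert_of_not_mem H x he' (by simp [hw]), ih hST.2 hT']
        simp [hne, hw]
    · have hne : H.tail e ≠ v := fun h' => hH e (h.trans h'.symm)
      by_cases hw : H.tail e ∈ W
      · rw [signedSum_insert H hH x he' hw (h ▸ hv), ih hST.2 hT',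
          signedSum_union_of_not_mem H x (v := v) (by simp [h]) T hST.2 hT', Finset.erase_right_comm]
        simp [h, hne, hw]
        ring
      · rw [signedSum_insert_of_not_mem H x he' (by simp [hw]), ih hST.2 hT']
        simp [hne, hw]

/-- The recurrence of the matching polynomial at a vertex. -/
theorem signedSum_eq_sub_sum (H : OrientedGraph N F) (hH : H.Loopless) (x : ℝ) {W : Finset N}
    {v : N} (hv : v ∈ W) :
    H.signedSum x W Finset.univ = x * H.signedSum x (W.erase v) Finset.univ -
      ∑ δ : H.Dart with H.h δ = v ∧ H.t δ ∈ W,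
        H.signedSum x ((W.erase v).erase (H.t δ)) Finset.univ := by
  set T : Finset F := {e | H.tail e = v ∨ H.head e = v} with hTdef
  have hT : ∀ e ∈ T, H.tail e = v ∨ H.head e = v := fun e he => by simpa [hTdef] using he
  have hU : T ∪ Tᶜ = Finset.univ := Finset.union_compl T
  have hd : Disjoint T Tᶜ := disjoint_compl_right
  have hTc : ∀ e ∈ Tᶜ, H.tail e ≠ v ∧ H.head e ≠ v := fun e he => by simpa [hTdef] using he
  have hdel : ∀ W' : Finset N, v ∉ W' →
      H.signedSum x W' Finset.univ = H.signedSum x W' Tᶜ := by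
    intro W' hW'
    rw [← hU, signedSum_union_of_not_mem H x hW' T hd hT]
  have hv' : v ∉ W.erase v := Finset.notMem_erase v W
  rw [← hU, signedSum_union H hH x hv T hd hT, signedSum_of_isolated H x hv hTc, hU, hdel _ hv',
    Finset.sum_congr rfl fun δ _ => hdel _ fun h => hv' (Finset.mem_of_mem_erase h)]
  congr 1
  have hzero : ∀ e, e ∉ T → H.edgeTerm x W Tᶜ v e = 0 := by
    intro e he
    obtain ⟨h1, h2⟩ := hTc e (Finset.mem_compl.2 he)
    simp [edgeTerm, h1, h2]
  rw [Finset.sum_subset (Finset.subset_univ T) fun e _ he => hzero e he, Finset.sum_filter,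
    Fintype.sum_sum_type, ← Finset.sum_add_distrib]
  rfl

/-- The ratio bound along the path tree: a positive supersolution on a space of lifts makes all
the matching polynomials positive. -/
theorem signedSum_pos (H : OrientedGraph N F) (hH : H.Loopless) {X : Type*} (p : X → N → Prop)
    (hp : ∀ w, ∃ z, p z w) (step : X → H.Dart → X)
    (hstep : ∀ z δ, p z (H.h δ) → p (step z δ) (H.t δ) ∧ step (step z δ) δ.swap = z)
    {g : X → ℝ} (hg : ∀ z, 0 < g z) {x y : ℝ} (hyx : y < x)
    (hsup : ∀ z w, p z w → ∑ δ : H.Dart with H.h δ = w, g (step z δ) ≤ y * g z) (W : Finset N) :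
    0 < H.signedSum x W Finset.univ := by
  -- The induction also carries a ratio bound. If the neighbour `H.t δ` is already removed, its term
  -- is absent from the recurrence, and the supersolution has `g (step z δ)` to spare.
  suffices h : ∀ n, ∀ W : Finset N, W.card ≤ n → 0 < H.signedSum x W Finset.univ ∧
      ∀ z δ, p z (H.h δ) → H.h δ ∈ W → H.t δ ∉ W →
        H.signedSum x (W.erase (H.h δ)) Finset.univ * g (step z δ) ≤
          H.signedSum x W Finset.univ * g z from (h W.card W le_rfl).1
  intro n
  induction n with
  | zero =>
    intro W hW
    obtain rfl : W = ∅ := by simpa using hW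
    exact ⟨by rw [signedSum_empty]; exact_mod_cast Fintype.card_pos, by simp⟩
  | succ n ih =>
    intro W hW
    have key : ∀ z w, p z w → w ∈ W → H.signedSum x (W.erase w) Finset.univ *
        (x * g z - ∑ δ : H.Dart with H.h δ = w ∧ H.t δ ∈ W, g (step z δ)) ≤
          H.signedSum x W Finset.univ * g z := by
      intro z w hz hw
      have hcard : (W.erase w).card ≤ n := by
        rw [Finset.card_erase_of_mem hw]; omega
      rw [signedSum_eq_sub_sum H hH x hw, sub_mul, mul_sub, Finset.mul_sum, Finset.sum_mul]
      have : ∑ δ : H.Dart with H.h δ = w ∧ H.t δ ∈ W,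
          H.signedSum x ((W.erase w).erase (H.t δ)) Finset.univ * g z ≤
          ∑ δ : H.Dart with H.h δ = w ∧ H.t δ ∈ W,
            H.signedSum x (W.erase w) Finset.univ * g (step z δ) := by
        refine Finset.sum_le_sum fun δ hδ => ?_
        obtain ⟨h1, h2⟩ : H.h δ = w ∧ H.t δ ∈ W := by simpa using hδ
        obtain ⟨h3, h4⟩ := hstep z δ (h1.symm ▸ hz)
        have hne : H.t δ ≠ w := by
          rw [← h1]
          rcases δ with e | e
          · exact (hH e).symm
          · exact hH e
        -- The ratio bound at the neighbour, seen through the reversed dart: the vertex missing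
        -- there is `w`, and the lift steps back to `z`.
        have := (ih (W.erase w) hcard).2 (step z δ) δ.swap (by rwa [h_swap])
          (by rw [h_swap]; exact Finset.mem_erase.2 ⟨hne, h2⟩) (by rw [t_swap, h1]; simp)
        rwa [h_swap, h4] at this
      linarith
    have herase : ∀ w ∈ W, 0 < H.signedSum x (W.erase w) Finset.univ := by
      intro w hw
      refine (ih _ ?_).1
      rw [Finset.card_erase_of_mem hw]; omega
    constructor
    · rcases W.eq_empty_or_nonempty with rfl | ⟨w, hw⟩
      · rw [signedSum_empty]; exact_mod_cast Fintype.card_pos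
      · obtain ⟨z, hz⟩ := hp w
        have h1 := key z w hz hw
        have h2 : ∑ δ : H.Dart with H.h δ = w ∧ H.t δ ∈ W, g (step z δ) ≤ y * g z := by
          refine le_trans (Finset.sum_le_sum_of_subset_of_nonneg ?_ fun _ _ _ => (hg _).le)
            (hsup z w hz)
          intro δ hδ
          simp only [Finset.mem_filter, Finset.mem_univ, true_and] at hδ ⊢
          exact hδ.1
        have h3 : y * g z < x * g z := by have := hg z; gcongr
        have h4 := mul_pos (herase w hw) (sub_pos.2 (h2.trans_lt h3))
        exact pos_of_mul_pos_left (h4.trans_le h1) (hg z).le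
    · intro z δ hz hw hδ
      refine le_trans (mul_le_mul_of_nonneg_left ?_ (herase _ hw).le) (key z _ hz hw)
      have h2 : g (step z δ) + ∑ δ' : H.Dart with H.h δ' = H.h δ ∧ H.t δ' ∈ W, g (step z δ') ≤
          y * g z := by
        refine le_trans ?_ (hsup z _ hz)
        rw [← Finset.sum_insert (f := fun δ => g (step z δ)) (by simp [hδ])]
        refine Finset.sum_le_sum_of_subset_of_nonneg ?_ fun _ _ _ => (hg _).le
        intro δ' hδ'
        simp only [Finset.mem_insert, Finset.mem_filter, Finset.mem_univ, true_and] at hδ' ⊢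
        rcases hδ' with rfl | h
        · rfl
        · exact h.1
      have h3 : y * g z < x * g z := by have := hg z; gcongr
      linarith

end OrientedGraph

/-! ### Exterior powers and mixing families -/

/-- The action of a matrix on an exterior power of `ℂ^d`. -/
noncomputable abbrev Matrix.exteriorMap {d : ℕ} (k : ℕ) (A : Matrix (Fin d) (Fin d) ℂ) :
    ⋀[ℂ]^k (Fin d → ℂ) →ₗ[ℂ] ⋀[ℂ]^k (Fin d → ℂ) :=
  exteriorPower.map k (Matrix.toLin' A)

theorem LinearMap.sum_comp_finset {ι R M M' M'' : Type*} [CommRing R] [AddCommGroup M]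
    [AddCommGroup M'] [AddCommGroup M''] [Module R M] [Module R M'] [Module R M''] (s : Finset ι)
    (f : ι → M' →ₗ[R] M'') (g : M →ₗ[R] M') : (∑ i ∈ s, f i) ∘ₗ g = ∑ i ∈ s, f i ∘ₗ g := by
  ext; simp [LinearMap.sum_apply]

theorem LinearMap.comp_sum_finset {ι R M M' M'' : Type*} [CommRing R] [AddCommGroup M]
    [AddCommGroup M'] [AddCommGroup M''] [Module R M] [Module R M'] [Module R M''] (s : Finset ι)
    (f : ι → M →ₗ[R] M') (g : M' →ₗ[R] M'') : g ∘ₗ (∑ i ∈ s, f i) = ∑ i ∈ s, g ∘ₗ f i := by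
  ext; simp [LinearMap.sum_apply]

namespace Matrix

variable {d : ℕ}

theorem exteriorMap_mul (k : ℕ) (A B : Matrix (Fin d) (Fin d) ℂ) :
    exteriorMap k (A * B) = exteriorMap k A ∘ₗ exteriorMap k B := by
  rw [exteriorMap, toLin'_mul, ← exteriorPower.map_comp]

theorem exteriorMap_one (k : ℕ) :
    exteriorMap k (1 : Matrix (Fin d) (Fin d) ℂ) = LinearMap.id := by
  rw [exteriorMap, toLin'_one, exteriorPower.map_id]

/-- A finite family of matrices `B g` with left inverses `B' g` is mixing if twirling by it projects
the linear maps between exterior powers of `ℂ^d` to the scalars. -/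
structure IsMixing {Λ : Type*} [Fintype Λ] (B B' : Λ → Matrix (Fin d) (Fin d) ℂ) : Prop where
  left_inv : ∀ g, B' g * B g = 1
  twirl_ne : ∀ k ≤ d, ∀ l ≤ d, k ≠ l →
    ∀ X : ⋀[ℂ]^l (Fin d → ℂ) →ₗ[ℂ] ⋀[ℂ]^k (Fin d → ℂ),
      ∑ g, exteriorMap k (B g) ∘ₗ X ∘ₗ exteriorMap l (B' g) = 0
  twirl_self : ∀ k ≤ d, ∀ X : ⋀[ℂ]^k (Fin d → ℂ) →ₗ[ℂ] ⋀[ℂ]^k (Fin d → ℂ),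
    ∃ c : ℂ, ∑ g, exteriorMap k (B g) ∘ₗ X ∘ₗ exteriorMap k (B' g) = c • LinearMap.id

section Compare

variable {Λ Λ₂ : Type*} [Fintype Λ] [Fintype Λ₂] {B B' : Λ → Matrix (Fin d) (Fin d) ℂ}
  {B₂ B₂' : Λ₂ → Matrix (Fin d) (Fin d) ℂ}

/-- A product of two coefficients is one coefficient of the twirl of the rank one map `ψ.smulRight
a`, to which Schur's lemma can be applied. -/
theorem sum_coeff_mul_coeff (B B' : Λ → Matrix (Fin d) (Fin d) ℂ) {k l : ℕ}
    (a : ⋀[ℂ]^k (Fin d → ℂ)) (b : ⋀[ℂ]^l (Fin d → ℂ)) (φ : Module.Dual ℂ (⋀[ℂ]^k (Fin d → ℂ)))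
    (ψ : Module.Dual ℂ (⋀[ℂ]^l (Fin d → ℂ))) :
    ∑ g, φ (exteriorMap k (B g) a) * ψ (exteriorMap l (B' g) b) =
      φ ((∑ g, exteriorMap k (B g) ∘ₗ (ψ.smulRight a) ∘ₗ exteriorMap l (B' g)) b) := by
  rw [LinearMap.sum_apply, map_sum]
  refine Finset.sum_congr rfl fun g _ => ?_
  rw [LinearMap.comp_apply, LinearMap.comp_apply, LinearMap.smulRight_apply, map_smul, map_smul,
    smul_eq_mul, mul_comm]

/-- Each summand is conjugate to `X`. The trace therefore determines the scalar in `twirl_self`,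
which is why mixing families cannot be told apart. -/
theorem IsMixing.trace_twirl (h : IsMixing B B') {k : ℕ}
    (X : ⋀[ℂ]^k (Fin d → ℂ) →ₗ[ℂ] ⋀[ℂ]^k (Fin d → ℂ)) :
    LinearMap.trace ℂ _ (∑ g, exteriorMap k (B g) ∘ₗ X ∘ₗ exteriorMap k (B' g)) =
      Fintype.card Λ * LinearMap.trace ℂ _ X := by
  rw [map_sum, Finset.sum_congr rfl (g := fun _ => LinearMap.trace ℂ _ X), Finset.sum_const,
    Finset.card_univ, nsmul_eq_mul]
  intro g _
  rw [LinearMap.trace_comp_comm', LinearMap.comp_assoc, ← exteriorMap_mul, h.left_inv,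
    exteriorMap_one, LinearMap.comp_id]

/-- All mixing families give the same averages of products of matrix coefficients of exterior
powers. -/
theorem IsMixing.average_eq (h : IsMixing B B') (h₂ : IsMixing B₂ B₂') {k l : ℕ}
    (hk : k ≤ d) (hl : l ≤ d)
    (a : ⋀[ℂ]^k (Fin d → ℂ)) (b : ⋀[ℂ]^l (Fin d → ℂ)) (φ : Module.Dual ℂ (⋀[ℂ]^k (Fin d → ℂ)))
    (ψ : Module.Dual ℂ (⋀[ℂ]^l (Fin d → ℂ))) :
    (Fintype.card Λ₂ : ℂ) * ∑ g, φ (exteriorMap k (B g) a) * ψ (exteriorMap l (B' g) b) =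
      (Fintype.card Λ : ℂ) * ∑ g, φ (exteriorMap k (B₂ g) a) * ψ (exteriorMap l (B₂' g) b) := by
  rw [sum_coeff_mul_coeff, sum_coeff_mul_coeff]
  by_cases hkl : k = l
  · subst hkl
    obtain ⟨c, hc⟩ := h.twirl_self k hk (ψ.smulRight a)
    obtain ⟨c₂, hc₂⟩ := h₂.twirl_self k hk (ψ.smulRight a)
    have t := h.trace_twirl (ψ.smulRight a)
    have t₂ := h₂.trace_twirl (ψ.smulRight a)
    rw [hc, map_smul, LinearMap.trace_id, smul_eq_mul] at t
    rw [hc₂, map_smul, LinearMap.trace_id, smul_eq_mul] at t₂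
    have hne : (Module.finrank ℂ (⋀[ℂ]^k (Fin d → ℂ)) : ℂ) ≠ 0 := by
      rw [exteriorPower.finrank_eq, Module.finrank_fin_fun]
      exact_mod_cast (Nat.choose_pos hk).ne'
    have hcc : (Fintype.card Λ₂ : ℂ) * c = Fintype.card Λ * c₂ := by
      apply mul_right_cancel₀ hne
      rw [mul_assoc, t, mul_assoc, t₂]
      ring
    rw [hc, hc₂]
    simp only [LinearMap.smul_apply, LinearMap.id_apply, map_smul, smul_eq_mul, ← mul_assoc, hcc]
  · rw [h.twirl_ne k hk l hl hkl, h₂.twirl_ne k hk l hl hkl]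
    simp

/-- The functions of two matrices that are combinations of products of a matrix coefficient of an
exterior power of the first and one of the second. -/
noncomputable def coeffSpan (d : ℕ) :
    Submodule ℂ (Matrix (Fin d) (Fin d) ℂ → Matrix (Fin d) (Fin d) ℂ → ℂ) :=
  Submodule.span ℂ {f | ∃ k ≤ d, ∃ l ≤ d, ∃ (a : ⋀[ℂ]^k (Fin d → ℂ)) (b : ⋀[ℂ]^l (Fin d → ℂ))
    (φ : Module.Dual ℂ (⋀[ℂ]^k (Fin d → ℂ))) (ψ : Module.Dual ℂ (⋀[ℂ]^l (Fin d → ℂ))),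
    f = fun A C => φ (exteriorMap k A a) * ψ (exteriorMap l C b)}

theorem IsMixing.average_eq_of_mem_coeffSpan (h : IsMixing B B') (h₂ : IsMixing B₂ B₂')
    {f : Matrix (Fin d) (Fin d) ℂ → Matrix (Fin d) (Fin d) ℂ → ℂ} (hf : f ∈ coeffSpan d) :
    (Fintype.card Λ₂ : ℂ) * ∑ g, f (B g) (B' g) = (Fintype.card Λ : ℂ) * ∑ g, f (B₂ g) (B₂' g) := by
  induction hf using Submodule.span_induction with
  | mem f hf =>
    obtain ⟨k, hk, l, hl, a, b, φ, ψ, rfl⟩ := hf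
    exact h.average_eq h₂ hk hl a b φ ψ
  | zero => simp
  | add f f' _ _ hf hf' =>
    simp only [Pi.add_apply, Finset.sum_add_distrib, mul_add, hf, hf']
  | smul c f _ hf =>
    simp only [Pi.smul_apply, smul_eq_mul, ← Finset.mul_sum]
    rw [mul_left_comm, hf, mul_left_comm]

end Compare

end Matrix

/-- By Schur's lemma, a representation with the property (P1) is mixing. -/
theorem PropertyP1.isMixing {Γ : Type*} [Group Γ] [Fintype Γ] {d : ℕ} {π : Γ →* GL (Fin d) ℂ}
    (h : PropertyP1 π) :
    Matrix.IsMixing (fun g => (π g : Matrix (Fin d) (Fin d) ℂ)) fun g => (π g⁻¹ : Matrix _ _ ℂ) := by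
  have hcomm : ∀ k l (X : ⋀[ℂ]^l (Fin d → ℂ) →ₗ[ℂ] ⋀[ℂ]^k (Fin d → ℂ)), ∀ s : Γ,
      (∑ g, Matrix.exteriorMap k (π g : Matrix (Fin d) (Fin d) ℂ) ∘ₗ X ∘ₗ
        Matrix.exteriorMap l (π g⁻¹ : Matrix (Fin d) (Fin d) ℂ)) ∘ₗ
          (matrixRep π).exteriorPow l s =
      (matrixRep π).exteriorPow k s ∘ₗ
        (∑ g, Matrix.exteriorMap k (π g : Matrix (Fin d) (Fin d) ℂ) ∘ₗ X ∘ₗ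
        Matrix.exteriorMap l (π g⁻¹ : Matrix (Fin d) (Fin d) ℂ)) := by
    intro k l X s
    have hs : ∀ m, (matrixRep π).exteriorPow m s =
        Matrix.exteriorMap m (π s : Matrix (Fin d) (Fin d) ℂ) := fun m => rfl
    conv_lhs => rw [← sum_mul_left_eq_sum s]
    rw [hs, hs, LinearMap.sum_comp_finset, LinearMap.comp_sum_finset]
    refine Finset.sum_congr rfl fun g _ => ?_
    rw [map_mul, Units.val_mul, Matrix.exteriorMap_mul, mul_inv_rev, LinearMap.comp_assoc,
      LinearMap.comp_assoc, LinearMap.comp_assoc, ← Matrix.exteriorMap_mul, ← Units.val_mul,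
      ← map_mul, inv_mul_cancel_right]
  refine ⟨fun g => ?_, fun k hk l hl hkl X => ?_, fun k hk X => ?_⟩
  · rw [← Units.val_mul, ← map_mul, inv_mul_cancel, map_one, Units.val_one]
  · have := h.1 k hk
    have := h.1 l hl
    have := h.2 l hl k hk hkl.symm
    exact congrArg Representation.IntertwiningMap.toLinearMap (Subsingleton.elim
      (⟨_, hcomm k l X⟩ : Representation.IntertwiningMap _ _) 0)
  · have := h.1 k hk
    obtain ⟨c, hc⟩ := (Representation.IsIrreducible.algebraMap_intertwiningMap_bijective_of_isAlgClosed
      (ρ := (matrixRep π).exteriorPow k)).2 ⟨_, hcomm k k X⟩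
    exact ⟨c, (congrArg Representation.IntertwiningMap.toLinearMap hc).symm⟩

/-! ### Signed permutation matrices as a mixing family -/

/-- The signed permutation matrix with entries `ε i` at the positions `(i, σ i)`. -/
def signedPermMatrix {d : ℕ} (q : (Fin d → ℤˣ) × Equiv.Perm (Fin d)) :
    Matrix (Fin d) (Fin d) ℂ :=
  fun i j => if q.2 i = j then ((q.1 i : ℤ) : ℂ) else 0

namespace signedPermMatrix

open Matrix

variable {d : ℕ}

/-- The index of the product of two signed permutation matrices. -/
def mulEquiv (q : (Fin d → ℤˣ) × Equiv.Perm (Fin d)) :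
    (Fin d → ℤˣ) × Equiv.Perm (Fin d) ≃ (Fin d → ℤˣ) × Equiv.Perm (Fin d) where
  toFun r := (fun i => q.1 i * r.1 (q.2 i), r.2 * q.2)
  invFun r := (fun i => (q.1 (q.2⁻¹ i))⁻¹ * r.1 (q.2⁻¹ i), r.2 * q.2⁻¹)
  left_inv r := by
    refine Prod.ext (funext fun i => ?_) (by simp)
    simp [← mul_assoc]
  right_inv r := by
    refine Prod.ext (funext fun i => ?_) (by simp)
    simp [← mul_assoc]

theorem mul_eq (q r : (Fin d → ℤˣ) × Equiv.Perm (Fin d)) :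
    signedPermMatrix (mulEquiv q r) = signedPermMatrix q * signedPermMatrix r := by
  ext i j
  rw [mul_apply, Finset.sum_eq_single (q.2 i)]
  · simp [signedPermMatrix, mulEquiv]
  · intro m _ hm
    simp [signedPermMatrix, Ne.symm hm]
  · simp

theorem transpose_mul_self (q : (Fin d → ℤˣ) × Equiv.Perm (Fin d)) :
    (signedPermMatrix q)ᵀ * signedPermMatrix q = 1 := by
  ext i j
  obtain ⟨i, rfl⟩ := q.2.surjective i
  rw [mul_apply, Finset.sum_eq_single i]
  · rcases Int.units_eq_one_or (q.1 i) with h | h <;> simp [signedPermMatrix, one_apply, h]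
  · intro m _ hm
    simp [signedPermMatrix, hm]
  · simp

theorem mulVec_single (q : (Fin d → ℤˣ) × Equiv.Perm (Fin d)) (j : Fin d) :
    toLin' (signedPermMatrix q) (Pi.basisFun ℂ (Fin d) (q.2 j)) =
      ((q.1 j : ℤ) : ℂ) • Pi.basisFun ℂ (Fin d) j := by
  ext i
  by_cases h : i = j
  · subst h; simp [signedPermMatrix]
  · simp [signedPermMatrix, h]

theorem exteriorMap_sign (k : ℕ) (ε : Fin d → ℤˣ) (s : Set.powersetCard (Fin d) k) :
    exteriorMap k (signedPermMatrix (ε, 1)) ((Pi.basisFun ℂ (Fin d)).exteriorPower k s) =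
      (∏ i ∈ s.1, ((ε i : ℤ) : ℂ)) • (Pi.basisFun ℂ (Fin d)).exteriorPower k s := by
  rw [exteriorPower.basis_apply, exteriorMap, exteriorPower.map_apply_ιMulti_family,
    exteriorPower.ιMulti_family, exteriorPower.ιMulti_family]
  have : (toLin' (signedPermMatrix (ε, 1)) ∘ Pi.basisFun ℂ (Fin d)) ∘
      (Set.powersetCard.ofFinEmbEquiv.symm s) = fun i =>
        ((ε (Set.powersetCard.ofFinEmbEquiv.symm s i) : ℤ) : ℂ) •
          (Pi.basisFun ℂ (Fin d) ∘ (Set.powersetCard.ofFinEmbEquiv.symm s)) i := by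
    funext i
    exact mulVec_single (ε, 1) _
  rw [this, AlternatingMap.map_smul_univ]
  congr 1
  rw [← Finset.prod_coe_sort s.1 fun i => ((ε i : ℤ) : ℂ), ← (Finset.orderIsoOfFin s.1 s.2).toEquiv.prod_comp
    fun i : s.1 => ((ε i : ℤ) : ℂ)]
  rfl

/-- `σ` carries the increasing enumeration of `t` to that of `s`, so no sign appears; the direction
is reversed because the matrix of `σ` sends the basis vector at `σ j` to the one at `j`. -/
theorem exists_exteriorMap_perm (k : ℕ) (s t : Set.powersetCard (Fin d) k) :
    ∃ σ : Equiv.Perm (Fin d),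
      exteriorMap k (signedPermMatrix (1, σ)) ((Pi.basisFun ℂ (Fin d)).exteriorPower k s) =
        (Pi.basisFun ℂ (Fin d)).exteriorPower k t := by
  have := Equiv.Perm.isMultiplyPretransitive (Fin d) k
  obtain ⟨σ, hσ⟩ := MulAction.exists_smul_eq (Equiv.Perm (Fin d))
    (Set.powersetCard.ofFinEmbEquiv.symm t).toEmbedding
    (Set.powersetCard.ofFinEmbEquiv.symm s).toEmbedding
  refine ⟨σ, ?_⟩
  rw [exteriorPower.basis_apply, exteriorPower.basis_apply, exteriorMap,
    exteriorPower.map_apply_ιMulti_family, exteriorPower.ιMulti_family, exteriorPower.ιMulti_family]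
  congr 1
  funext i
  have hi : (Set.powersetCard.ofFinEmbEquiv.symm s) i =
      σ ((Set.powersetCard.ofFinEmbEquiv.symm t) i) := (DFunLike.congr_fun hσ i).symm
  have := mulVec_single (1, σ) ((Set.powersetCard.ofFinEmbEquiv.symm t) i)
  simp only [Function.comp_apply, hi]
  rw [this]
  simp

theorem coord_exteriorMap_sign (k : ℕ) (ε : Fin d → ℤˣ) (s : Set.powersetCard (Fin d) k)
    (z : ⋀[ℂ]^k (Fin d → ℂ)) :
    ((Pi.basisFun ℂ (Fin d)).exteriorPower k).coord s
        (exteriorMap k (signedPermMatrix (ε, 1)) z) =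
      (∏ i ∈ s.1, ((ε i : ℤ) : ℂ)) * ((Pi.basisFun ℂ (Fin d)).exteriorPower k).coord s z := by
  set b := (Pi.basisFun ℂ (Fin d)).exteriorPower k with hb
  suffices h : b.coord s ∘ₗ exteriorMap k (signedPermMatrix (ε, 1)) =
      (∏ i ∈ s.1, ((ε i : ℤ) : ℂ)) • b.coord s from LinearMap.congr_fun h z
  refine b.ext fun t => ?_
  rw [LinearMap.comp_apply, hb, exteriorMap_sign, ← hb]
  by_cases hst : t = s
  · subst hst; simp
  · simp [hst]

/-- Diagonal sign matrices act on the wedge basis by characters that distinguish subsets: flipping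
the sign at one `j` in the symmetric difference of `s` and `t` negates the coefficient. -/
theorem coord_eq_zero_of_commute {k l : ℕ} {Y : ⋀[ℂ]^l (Fin d → ℂ) →ₗ[ℂ] ⋀[ℂ]^k (Fin d → ℂ)}
    (hY : ∀ q, exteriorMap k (signedPermMatrix q) ∘ₗ Y = Y ∘ₗ exteriorMap l (signedPermMatrix q))
    (s : Set.powersetCard (Fin d) k) (t : Set.powersetCard (Fin d) l) (hst : s.1 ≠ t.1) :
    ((Pi.basisFun ℂ (Fin d)).exteriorPower k).coord s
      (Y ((Pi.basisFun ℂ (Fin d)).exteriorPower l t)) = 0 := by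
  obtain ⟨j, hj⟩ : ∃ j, ¬ (j ∈ s.1 ↔ j ∈ t.1) := by
    by_contra! h
    exact hst (Finset.ext h)
  set ε : Fin d → ℤˣ := fun i => if i = j then -1 else 1 with hε
  have hprod : ∀ u : Finset (Fin d), ∏ i ∈ u, ((ε i : ℤ) : ℂ) = if j ∈ u then -1 else 1 := by
    intro u
    rw [← Finset.prod_ite_eq' u j (fun _ => (-1 : ℂ))]
    refine Finset.prod_congr rfl fun i _ => ?_
    rw [hε]
    by_cases h : i = j <;> simp [h]
  have h1 := congrArg (((Pi.basisFun ℂ (Fin d)).exteriorPower k).coord s)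
    (LinearMap.congr_fun (hY (ε, 1)) ((Pi.basisFun ℂ (Fin d)).exteriorPower l t))
  rw [LinearMap.comp_apply, LinearMap.comp_apply, coord_exteriorMap_sign, exteriorMap_sign,
    map_smul, map_smul, hprod, hprod, smul_eq_mul] at h1
  by_cases h2 : j ∈ s.1 <;> by_cases h3 : j ∈ t.1
  · exact absurd (iff_of_true h2 h3) hj
  · rw [if_pos h2, if_neg h3] at h1
    linear_combination (-1 / 2 : ℂ) * h1
  · rw [if_neg h2, if_pos h3] at h1
    linear_combination (1 / 2 : ℂ) * h1
  · exact absurd (iff_of_false h2 h3) hj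

/-- The signed permutation matrices form a mixing family. -/
theorem isMixing (d : ℕ) : IsMixing (signedPermMatrix (d := d)) fun q => (signedPermMatrix q)ᵀ := by
  have hcomm : ∀ k l (X : ⋀[ℂ]^l (Fin d → ℂ) →ₗ[ℂ] ⋀[ℂ]^k (Fin d → ℂ)), ∀ q,
      exteriorMap k (signedPermMatrix q) ∘ₗ (∑ r, exteriorMap k (signedPermMatrix r) ∘ₗ X ∘ₗ
        exteriorMap l (signedPermMatrix r)ᵀ) =
      (∑ r, exteriorMap k (signedPermMatrix r) ∘ₗ X ∘ₗ exteriorMap l (signedPermMatrix r)ᵀ) ∘ₗ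
        exteriorMap l (signedPermMatrix q) := by
    intro k l X q
    conv_rhs => rw [← Equiv.sum_comp (mulEquiv q)]
    rw [LinearMap.sum_comp_finset, LinearMap.comp_sum_finset]
    refine Finset.sum_congr rfl fun r _ => ?_
    rw [mul_eq, transpose_mul, exteriorMap_mul, LinearMap.comp_assoc,
      LinearMap.comp_assoc, LinearMap.comp_assoc, ← exteriorMap_mul l, mul_assoc,
      transpose_mul_self, mul_one]
  refine ⟨transpose_mul_self, fun k hk l hl hkl X => ?_, fun k hk X => ?_⟩
  · refine ((Pi.basisFun ℂ (Fin d)).exteriorPower l).ext fun t => ?_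
    refine ((Pi.basisFun ℂ (Fin d)).exteriorPower k).ext_elem fun s => ?_
    have := coord_eq_zero_of_commute (hcomm k l X) s t fun h => hkl (by rw [← s.2, ← t.2, h])
    simpa using this
  · set Y := ∑ r, exteriorMap k (signedPermMatrix r) ∘ₗ X ∘ₗ exteriorMap k (signedPermMatrix r)ᵀ
      with hYdef
    set b := (Pi.basisFun ℂ (Fin d)).exteriorPower k with hb
    have hdiag : ∀ s, Y (b s) = b.coord s (Y (b s)) • b s := by
      intro s
      refine b.ext_elem fun t => ?_
      by_cases hst : t = s
      · subst hst; simp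
      · have := coord_eq_zero_of_commute (hcomm k k X) t s fun h => hst (Subtype.ext h)
        rw [← hYdef, ← hb, Module.Basis.coord_apply] at this
        simp [this, Ne.symm hst]
    have hconst : ∀ s t, b.coord s (Y (b s)) = b.coord t (Y (b t)) := by
      intro s t
      obtain ⟨σ, hσ⟩ := exists_exteriorMap_perm k s t
      have h1 := LinearMap.congr_fun (hcomm k k X (1, σ)) (b s)
      rw [← hYdef, LinearMap.comp_apply, LinearMap.comp_apply, hσ, ← hb, hdiag s, map_smul,
        hσ] at h1
      rw [← h1, ← hb]
      simp
    rcases isEmpty_or_nonempty (Set.powersetCard (Fin d) k) with he | ⟨⟨s₀⟩⟩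
    · exact ⟨0, b.ext fun s => (he.false s).elim⟩
    · exact ⟨b.coord s₀ (Y (b s₀)), b.ext fun s => by
        rw [hdiag s, hconst s s₀]; simp⟩

end signedPermMatrix

/-! ### Block determinants as combinations of exterior coefficients -/

theorem Function.extend_update_comp {α ι M M' : Type*} [DecidableEq α] [DecidableEq ι] {e : α → ι}
    (he : Function.Injective e) (L : M' → M) (z : ι → M) (b : α → M') (i : α) (x : M') :
    Function.extend e (L ∘ Function.update b i x) z =
      Function.update (Function.extend e (L ∘ b) z) (e i) (L x) := by
  funext q
  by_cases hq : ∃ a, e a = q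
  · obtain ⟨a, rfl⟩ := hq
    rw [he.extend_apply]
    by_cases ha : a = i
    · subst ha; simp
    · rw [Function.update_of_ne (he.ne ha), he.extend_apply]
      simp [ha]
  · rw [Function.extend_apply' _ _ _ hq, Function.update_of_ne, Function.extend_apply' _ _ _ hq]
    rintro rfl
    exact hq ⟨i, rfl⟩

theorem Function.extend_extend_comm {α β ι M : Type*} {e : α → ι} {e' : β → ι}
    (he : Function.Injective e) (he' : Function.Injective e') (hdisj : ∀ a b, e a ≠ e' b)
    (f : α → M) (f' : β → M) (z : ι → M) :
    Function.extend e f (Function.extend e' f' z) =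
      Function.extend e' f' (Function.extend e f z) := by
  funext q
  by_cases hq : ∃ a, e a = q
  · obtain ⟨a, rfl⟩ := hq
    rw [he.extend_apply, Function.extend_apply' _ _ _ (fun ⟨b, hb⟩ => hdisj a b hb.symm),
      he.extend_apply]
  · rw [Function.extend_apply' _ _ _ hq]
    by_cases hq' : ∃ b, e' b = q
    · obtain ⟨b, rfl⟩ := hq'
      rw [he'.extend_apply, he'.extend_apply]
    · rw [Function.extend_apply' _ _ _ hq', Function.extend_apply' _ _ _ hq',
        Function.extend_apply' _ _ _ hq]

/-- The restriction of an alternating map to the variables in the range of `e`, each composed with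
the linear map `L`; the other variables have the values `z`. -/
noncomputable def AlternatingMap.partialExtend {R M M' P ι α : Type*} [CommRing R] [AddCommGroup M]
    [AddCommGroup M'] [AddCommGroup P] [Module R M] [Module R M'] [Module R P] [DecidableEq ι]
    (f : M [⋀^ι]→ₗ[R] P) (e : α → ι) (he : Function.Injective e) (L : M' →ₗ[R] M) (z : ι → M) :
    M' [⋀^α]→ₗ[R] P where
  toFun b := f (Function.extend e (L ∘ b) z)
  map_update_add' {inst} b i x y := by
    simp only [Function.extend_update_comp he, map_add, f.map_update_add]
  map_update_smul' {inst} b i c x := by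
    simp only [Function.extend_update_comp he, map_smul, f.map_update_smul]
  map_eq_zero_of_eq' b i j hij hne := by
    refine f.map_eq_zero_of_eq _ ?_ (he.ne hne)
    simp [he.extend_apply, hij]

namespace Matrix

variable {d : ℕ}

/-- Being alternating in the first group of variables, `f` factors through the `k`-th exterior
power. Expanding there in the wedge basis leaves, for each basis element, a form alternating in the
second group, which factors through the `l`-th exterior power. -/
theorem exists_sum_coeff_of_alternating {ι M : Type*} [DecidableEq ι] [AddCommGroup M] [Module ℂ M]
    (f : M [⋀^ι]→ₗ[ℂ] ℂ) {k l : ℕ} {e : Fin k → ι} {e' : Fin l → ι}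
    (he : Function.Injective e) (he' : Function.Injective e') (hdisj : ∀ a b, e a ≠ e' b)
    (L L' : (Fin d → ℂ) →ₗ[ℂ] M) (z : ι → M) (hk : k ≤ d) (hl : l ≤ d)
    (b : Fin k → Fin d → ℂ) (c : Fin l → Fin d → ℂ) :
    (fun B C => f (Function.extend e (L ∘ fun i => toLin' B (b i))
      (Function.extend e' (L' ∘ fun i => toLin' C (c i)) z))) ∈ coeffSpan d := by
  set β := (Pi.basisFun ℂ (Fin d)).exteriorPower k with hβ
  set w : Set.powersetCard (Fin d) k → Fin k → Fin d → ℂ := fun s =>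
    Pi.basisFun ℂ (Fin d) ∘ Set.powersetCard.ofFinEmbEquiv.symm s with hw
  set ψ : Set.powersetCard (Fin d) k → Module.Dual ℂ (⋀[ℂ]^l (Fin d → ℂ)) := fun s =>
    exteriorPower.alternatingMapLinearEquiv
      (f.partialExtend e' he' L' (Function.extend e (L ∘ w s) z)) with hψ
  have key : (fun B C => f (Function.extend e (L ∘ fun i => toLin' B (b i))
      (Function.extend e' (L' ∘ fun i => toLin' C (c i)) z))) =
      ∑ s, fun B C => β.coord s (exteriorMap k B (exteriorPower.ιMulti ℂ k b)) *
        ψ s (exteriorMap l C (exteriorPower.ιMulti ℂ l c)) := by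
    funext B C
    set φ := exteriorPower.alternatingMapLinearEquiv (f.partialExtend e he L
      (Function.extend e' (L' ∘ fun i => toLin' C (c i)) z)) with hφ
    have h1 : f (Function.extend e (L ∘ fun i => toLin' B (b i))
        (Function.extend e' (L' ∘ fun i => toLin' C (c i)) z)) =
        φ (exteriorMap k B (exteriorPower.ιMulti ℂ k b)) := by
      rw [exteriorMap, exteriorPower.map_apply_ιMulti, hφ,
        exteriorPower.alternatingMapLinearEquiv_apply_ιMulti]
      rfl
    have h2 : ∀ s, φ (β s) = ψ s (exteriorMap l C (exteriorPower.ιMulti ℂ l c)) := by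
      intro s
      rw [hβ, exteriorPower.basis_apply, exteriorPower.ιMulti_family, hφ,
        exteriorPower.alternatingMapLinearEquiv_apply_ιMulti, hψ, exteriorMap,
        exteriorPower.map_apply_ιMulti, exteriorPower.alternatingMapLinearEquiv_apply_ιMulti]
      exact congrArg f (Function.extend_extend_comm he he' hdisj _ _ _)
    rw [h1, ← β.sum_repr (exteriorMap k B (exteriorPower.ιMulti ℂ k b)), map_sum]
    simp only [Finset.sum_apply, map_smul, smul_eq_mul, h2, Module.Basis.coord_apply]
  rw [key]
  refine Submodule.sum_mem _ fun s _ => Submodule.subset_span ?_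
  exact ⟨k, hk, l, hl, _, _, _, _, rfl⟩

variable {V : Type*} [DecidableEq V]

/-- The block matrix with the block `B` at the position `(u, v)` and zeros elsewhere. -/
def place (u v : V) (B : Matrix (Fin d) (Fin d) ℂ) : Matrix (V × Fin d) (V × Fin d) ℂ :=
  fun p q => if p.1 = u ∧ q.1 = v then B p.2 q.2 else 0

/-- The inclusion of `ℂ^d` as the block `u`. -/
def blockInclusion (d : ℕ) (u : V) : (Fin d → ℂ) →ₗ[ℂ] (V × Fin d → ℂ) where
  toFun w p := if p.1 = u then w p.2 else 0
  map_add' w w' := by ext p; by_cases h : p.1 = u <;> simp [h]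
  map_smul' c w := by ext p; by_cases h : p.1 = u <;> simp [h]

/-- Expand by columns, choosing the set `s` of columns that come from the edge. Those in the block
`v` are columns of `B`, those in the block `u` columns of `C`, and since `u ≠ v` the two groups are
disjoint. -/
theorem det_add_place_mem_coeffSpan [Fintype V] (M : Matrix (V × Fin d) (V × Fin d) ℂ) {u v : V}
    (huv : u ≠ v) : (fun B C => (M + (place u v B + place v u C)).det) ∈ coeffSpan d := by
  set rN : Matrix (Fin d) (Fin d) ℂ → Matrix (Fin d) (Fin d) ℂ → V × Fin d → V × Fin d → ℂ :=
    fun B C q p => (place u v B + place v u C) p q with hrN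
  set rM : V × Fin d → V × Fin d → ℂ := fun q p => M p q with hrM
  have hexp : (fun B C => (M + (place u v B + place v u C)).det) = ∑ s : Finset (V × Fin d),
      fun B C => detRowAlternating (R := ℂ)
        (s.piecewise (rN B C) rM) := by
    funext B C
    rw [← det_transpose, transpose_add, add_comm]
    simp only [Finset.sum_apply]
    exact MultilinearMap.map_add_univ (detRowAlternating (R := ℂ) (n := V × Fin d)).toMultilinearMap
      (rN B C) rM
  rw [hexp]
  refine Submodule.sum_mem _ fun s _ => ?_
  -- The edge contributes zero columns outside the blocks `u` and `v`.
  by_cases hs : ∃ q ∈ s, q.1 ≠ u ∧ q.1 ≠ v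
  · obtain ⟨q, hq, h1, h2⟩ := hs
    have : (fun B C : Matrix (Fin d) (Fin d) ℂ => detRowAlternating (R := ℂ)
        (s.piecewise (rN B C) rM)) = 0 := by
      funext B C
      refine det_eq_zero_of_row_eq_zero q fun p => ?_
      rw [Finset.piecewise_eq_of_mem _ _ _ hq]
      simp [hrN, place, h1, h2]
    rw [this]
    exact Submodule.zero_mem _
  · push Not at hs
    set J : Finset (Fin d) := {j | (v, j) ∈ s} with hJ
    set K : Finset (Fin d) := {j | (u, j) ∈ s} with hK
    set e : Fin J.card → V × Fin d := fun i => (v, J.orderEmbOfFin rfl i) with he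
    set e' : Fin K.card → V × Fin d := fun i => (u, K.orderEmbOfFin rfl i) with he'
    have hinj : Function.Injective e := fun i j h =>
      (J.orderEmbOfFin rfl).injective (Prod.ext_iff.1 h).2
    have hinj' : Function.Injective e' := fun i j h =>
      (K.orderEmbOfFin rfl).injective (Prod.ext_iff.1 h).2
    have hJmem : ∀ j, (v, j) ∈ s → ∃ i, J.orderEmbOfFin rfl i = j := by
      intro j hj
      have : j ∈ Set.range (J.orderEmbOfFin rfl) := by
        rw [Finset.range_orderEmbOfFin]; simpa [hJ] using hj
      exact this
    have hKmem : ∀ j, (u, j) ∈ s → ∃ i, K.orderEmbOfFin rfl i = j := by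
      intro j hj
      have : j ∈ Set.range (K.orderEmbOfFin rfl) := by
        rw [Finset.range_orderEmbOfFin]; simpa [hK] using hj
      exact this
    have hmemJ : ∀ i, e i ∈ s := fun i => by
      have := J.orderEmbOfFin_mem rfl i
      exact (Finset.mem_filter.1 this).2
    have hmemK : ∀ i, e' i ∈ s := fun i => by
      have := K.orderEmbOfFin_mem rfl i
      exact (Finset.mem_filter.1 this).2
    have hdisj : ∀ a b, e a ≠ e' b := fun a b h => huv (Prod.ext_iff.1 h).1.symm
    have key := exists_sum_coeff_of_alternating (detRowAlternating (R := ℂ) (n := V × Fin d))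
      hinj hinj' hdisj (blockInclusion d u) (blockInclusion d v) rM
      ((Finset.card_le_univ J).trans (by simp)) ((Finset.card_le_univ K).trans (by simp))
      (fun i => Pi.single (J.orderEmbOfFin rfl i) 1) (fun i => Pi.single (K.orderEmbOfFin rfl i) 1)
    refine (congrArg (· ∈ coeffSpan d) ?_).mp key
    funext B C
    congr 1
    funext q
    by_cases hq : q ∈ s
    · rw [Finset.piecewise_eq_of_mem _ _ _ hq]
      obtain ⟨q1, q2⟩ := q
      by_cases hqu : q1 = u
      · subst hqu
        obtain ⟨i, rfl⟩ := hKmem q2 hq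
        rw [Function.extend_apply' _ _ _ (fun ⟨a, ha⟩ => hdisj a i ha)]
        rw [show (q1, K.orderEmbOfFin rfl i) = e' i from rfl, hinj'.extend_apply]
        funext p
        simp [hrN, blockInclusion, place, he', huv]
      · have hqv : q1 = v := hs _ hq hqu
        rw [hqv] at hq hqu ⊢
        obtain ⟨i, rfl⟩ := hJmem _ hq
        rw [show (v, J.orderEmbOfFin rfl i) = e i from rfl, hinj.extend_apply]
        funext p
        simp [hrN, blockInclusion, place, he, hqu]
    · rw [Finset.piecewise_eq_of_notMem _ _ _ hq,
        Function.extend_apply' _ _ _ (fun ⟨a, ha⟩ => hq (ha ▸ hmemJ a)),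
        Function.extend_apply' _ _ _ (fun ⟨a, ha⟩ => hq (ha ▸ hmemK a))]

end Matrix

/-! ### Replacing the random matrices edge by edge -/

section Resample

variable {E Λ M : Type*} [Fintype E] [DecidableEq E] [Fintype Λ] [AddCommMonoid M]

/-- Exchanging `γ e` with the fresh value `g` is an involution of the pairs. -/
theorem sum_sum_update (e : E) (h : (E → Λ) → M) :
    ∑ γ : E → Λ, ∑ g : Λ, h (Function.update γ e g) = Fintype.card Λ • ∑ γ, h γ := by
  let σ : (E → Λ) × Λ ≃ (E → Λ) × Λ :=
    { toFun := fun p => (Function.update p.1 e p.2, p.1 e)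
      invFun := fun p => (Function.update p.1 e p.2, p.1 e)
      left_inv := fun p => by simp
      right_inv := fun p => by simp }
  rw [← Fintype.sum_prod_type' (f := fun γ g => h (Function.update γ e g))]
  refine (Equiv.sum_comp σ (fun p => h p.1)).trans ?_
  rw [Fintype.sum_prod_type, Finset.smul_sum]
  simp

end Resample

namespace Matrix

variable {d : ℕ}

/-- All mixing families give the same average of a function of matrices attached to the elements of
`E`, if the function is for each element a combination of products of coefficients. -/
theorem IsMixing.pi_average_eq {Λ Λ₂ E : Type*} [Fintype Λ] [Fintype Λ₂] [Nonempty Λ] [Nonempty Λ₂]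
    [Fintype E] [DecidableEq E] {B B' : Λ → Matrix (Fin d) (Fin d) ℂ}
    {B₂ B₂' : Λ₂ → Matrix (Fin d) (Fin d) ℂ} (h : IsMixing B B') (h₂ : IsMixing B₂ B₂')
    (f : (E → Matrix (Fin d) (Fin d) ℂ) → (E → Matrix (Fin d) (Fin d) ℂ) → ℂ)
    (hf : ∀ e X Y, (fun A C => f (Function.update X e A) (Function.update Y e C)) ∈ coeffSpan d) :
    (Fintype.card (E → Λ₂) : ℂ) * ∑ γ : E → Λ, f (fun e => B (γ e)) (fun e => B' (γ e)) =
      (Fintype.card (E → Λ) : ℂ) * ∑ γ : E → Λ₂, f (fun e => B₂ (γ e)) (fun e => B₂' (γ e)) := by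
  -- Hybrids: the edges in `S` carry the second family, the others the first. The average does not
  -- change when one edge is added to `S`.
  set mix : Finset E → (E → Λ) → (E → Λ₂) → E → Matrix (Fin d) (Fin d) ℂ :=
    fun S γ η e => if e ∈ S then B₂ (η e) else B (γ e) with hmix
  set mix' : Finset E → (E → Λ) → (E → Λ₂) → E → Matrix (Fin d) (Fin d) ℂ :=
    fun S γ η e => if e ∈ S then B₂' (η e) else B' (γ e) with hmix'
  set Q : Finset E → ℂ := fun S => ∑ γ, ∑ η, f (mix S γ η) (mix' S γ η) with hQ
  have hstep : ∀ e S, e ∉ S → Q S = Q (insert e S) := by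
    intro e S he
    have h1 : (Fintype.card Λ : ℂ) * Q S = ∑ γ, ∑ η, ∑ g,
        f (Function.update (mix S γ η) e (B g)) (Function.update (mix' S γ η) e (B' g)) := by
      rw [← nsmul_eq_mul, ← sum_sum_update e]
      refine Finset.sum_congr rfl fun γ _ => ?_
      rw [Finset.sum_comm]
      refine Finset.sum_congr rfl fun η _ => Finset.sum_congr rfl fun g _ => ?_
      congr 1 <;>
      · funext e'
        by_cases hee : e' = e
        · subst hee; simp [hmix, hmix', he]
        · simp [hmix, hmix', hee]
    have h2 : (Fintype.card Λ₂ : ℂ) * Q (insert e S) = ∑ γ, ∑ η, ∑ g,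
        f (Function.update (mix S γ η) e (B₂ g)) (Function.update (mix' S γ η) e (B₂' g)) := by
      rw [hQ, Finset.mul_sum]
      refine Finset.sum_congr rfl fun γ _ => ?_
      rw [← nsmul_eq_mul, ← sum_sum_update e]
      refine Finset.sum_congr rfl fun η _ => Finset.sum_congr rfl fun g _ => ?_
      congr 1 <;>
      · funext e'
        by_cases hee : e' = e
        · subst hee; simp [hmix, hmix', he]
        · simp [hmix, hmix', hee]
    have h3 : (Fintype.card Λ₂ : ℂ) * (Fintype.card Λ * Q S) =
        Fintype.card Λ * (Fintype.card Λ₂ * Q (insert e S)) := by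
      rw [h1, h2, Finset.mul_sum, Finset.mul_sum]
      refine Finset.sum_congr rfl fun γ _ => ?_
      rw [Finset.mul_sum, Finset.mul_sum]
      exact Finset.sum_congr rfl fun η _ => h.average_eq_of_mem_coeffSpan h₂ (hf e _ _)
    have hc : (Fintype.card Λ₂ : ℂ) * Fintype.card Λ ≠ 0 := by
      simp [Fintype.card_ne_zero]
    exact mul_left_cancel₀ hc (by linear_combination h3)
  have hall : ∀ S, Q ∅ = Q S := by
    intro S
    induction S using Finset.induction_on with
    | empty => rfl
    | insert e S he ih => rw [ih, hstep e S he]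
  have := hall Finset.univ
  simp only [hQ, hmix, hmix', Finset.notMem_empty, if_false, Finset.mem_univ, if_true,
    Finset.sum_const, Finset.card_univ, nsmul_eq_mul] at this
  rw [← this, Finset.mul_sum]

end Matrix

namespace OrientedGraph

open Matrix

variable {V E : Type*} [Fintype V] [DecidableEq V] [Fintype E] {d : ℕ}

/-- The block matrix of a graph whose edges carry the matrices `X e` in the chosen direction and
`Y e` in the opposite direction. -/
def blockMatrix (G : OrientedGraph V E) (X Y : E → Matrix (Fin d) (Fin d) ℂ) :
    Matrix (V × Fin d) (V × Fin d) ℂ :=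
  ∑ e, (place (G.tail e) (G.head e) (X e) + place (G.head e) (G.tail e) (Y e))

theorem det_sub_blockMatrix_update_mem_coeffSpan [DecidableEq E] (G : OrientedGraph V E)
    (hG : G.Loopless) (M : Matrix (V × Fin d) (V × Fin d) ℂ) (e : E)
    (X Y : E → Matrix (Fin d) (Fin d) ℂ) :
    (fun A C => (M + G.blockMatrix (Function.update X e A) (Function.update Y e C)).det)
      ∈ coeffSpan d := by
  refine (congrArg (· ∈ coeffSpan d) ?_).mp (det_add_place_mem_coeffSpan
    (M + ∑ e' ∈ Finset.univ.erase e, (place (G.tail e') (G.head e') (X e') +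
      place (G.head e') (G.tail e') (Y e'))) (hG e).symm)
  funext A C
  rw [blockMatrix, ← Finset.sum_erase_add _ _ (Finset.mem_univ e), Function.update_self,
    Function.update_self, add_assoc]
  congr 3
  refine Finset.sum_congr rfl fun e' he' => ?_
  rw [Function.update_of_ne (Finset.ne_of_mem_erase he'),
    Function.update_of_ne (Finset.ne_of_mem_erase he')]

end OrientedGraph

/-! ### Covers of the graph and the average characteristic polynomial -/

namespace OrientedGraph

open Matrix

variable {V E : Type*} {d : ℕ}

/-- The covering graph with the permutation voltages `σ`. -/
def cover (G : OrientedGraph V E) (σ : E → Equiv.Perm (Fin d)) :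
    OrientedGraph (V × Fin d) (E × Fin d) where
  head e := (G.head e.1, σ e.1 e.2)
  tail e := (G.tail e.1, e.2)

/-- The projection of the darts of a cover. -/
def coverProj (G : OrientedGraph V E) (σ : E → Equiv.Perm (Fin d)) (δ : (G.cover σ).Dart) :
    G.Dart := Sum.map Prod.fst Prod.fst δ

theorem cover_loopless {G : OrientedGraph V E} (hG : G.Loopless) (σ : E → Equiv.Perm (Fin d)) :
    (G.cover σ).Loopless := fun e h => hG e.1 (congrArg Prod.fst h)

theorem h_coverProj (G : OrientedGraph V E) (σ : E → Equiv.Perm (Fin d)) (δ : (G.cover σ).Dart) :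
    G.h (G.coverProj σ δ) = ((G.cover σ).h δ).1 := by
  cases δ <;> rfl

theorem t_coverProj (G : OrientedGraph V E) (σ : E → Equiv.Perm (Fin d)) (δ : (G.cover σ).Dart) :
    G.t (G.coverProj σ δ) = ((G.cover σ).t δ).1 := by
  cases δ <;> rfl

theorem coverProj_swap (G : OrientedGraph V E) (σ : E → Equiv.Perm (Fin d))
    (δ : (G.cover σ).Dart) : G.coverProj σ δ.swap = (G.coverProj σ δ).swap := by
  cases δ <;> rfl

/-- Covers are locally injective because the voltages are permutations. -/
theorem coverProj_injOn (G : OrientedGraph V E) (σ : E → Equiv.Perm (Fin d)) (w : V × Fin d) :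
    Set.InjOn (G.coverProj σ) {δ | (G.cover σ).h δ = w} := by
  rintro (⟨e, i⟩ | ⟨e, i⟩) hδ (⟨e', i'⟩ | ⟨e', i'⟩) hδ' h
  · obtain rfl : e = e' := Sum.inl.inj h
    have : σ e i = σ e i' := congrArg Prod.snd (hδ.trans hδ'.symm)
    rw [(σ e).injective this]
  · cases h
  · cases h
  · obtain rfl : e = e' := Sum.inr.inj h
    have : i = i' := congrArg Prod.snd (hδ.trans hδ'.symm)
    rw [this]

variable [Fintype V] [DecidableEq V] [Fintype E] [DecidableEq E]

/-- The matching polynomials of the covers of `G` are positive above `ρ(G)`. -/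
theorem signedSum_cover_pos (G : OrientedGraph V E) (hconn : G.Connected) (hG : G.Loopless) (v₀ : V)
    (σ : E → Equiv.Perm (Fin d)) {x : ℝ} (hx : G.rho v₀ < x) :
    0 < (G.cover σ).signedSum x Finset.univ Finset.univ := by
  classical
  obtain ⟨y, hy, hyx⟩ := exists_between hx
  obtain ⟨g, hg, hsup⟩ := G.exists_supersolution v₀ hy
  refine signedSum_pos (G.cover σ) (cover_loopless hG σ)
    -- The tree of `G` serves for all its covers: a vertex of a cover is lifted to any walk that
    -- starts at its projection.
    (fun (z : G.ReducedWalk v₀) w => z.start = w.1)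
    (fun w => ReducedWalk.start_surjective hconn v₀ w.1) (fun z δ => z.step (G.coverProj σ δ))
    (fun z δ hz => ⟨?_, ?_⟩) hg hyx (fun z w hz => ?_) _
  · rw [← t_coverProj, z.start_step _ (by rw [h_coverProj, hz])]
  · rw [coverProj_swap]
    exact z.step_step_swap _ (by rw [h_coverProj, hz])
  · refine le_trans ?_ (hsup z)
    rw [← Finset.sum_image (f := fun δ => g (z.step δ)) (g := G.coverProj σ)
      (by simpa using G.coverProj_injOn σ w)]
    refine Finset.sum_le_sum_of_subset_of_nonneg ?_ fun _ _ _ => (hg _).le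
    intro δ hδ
    obtain ⟨δ', hδ', rfl⟩ := Finset.mem_image.1 hδ
    have : (G.cover σ).h δ' = w := by simpa using hδ'
    simp [h_coverProj, this, hz]

/-- Labeling edges by signed permutation matrices amounts to choosing a permutation cover and a
signing of its edges. -/
theorem map_signedMatrix_cover (G : OrientedGraph V E) (σ : E → Equiv.Perm (Fin d))
    (ε : E → Fin d → ℤˣ) (x : ℝ) :
    ((G.cover σ).signedMatrix x Finset.univ (fun e => ε e.1 e.2)).map Complex.ofRealHom =
      (x : ℂ) • 1 - G.blockMatrix (fun e => signedPermMatrix (ε e, σ e))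
        (fun e => (signedPermMatrix (ε e, σ e))ᵀ) := by
  have hx : (x • (1 : Matrix (V × Fin d) (V × Fin d) ℝ)).map Complex.ofRealHom = (x : ℂ) • 1 := by
    ext p q
    by_cases h : p = q <;> simp [h, one_apply]
  rw [signedMatrix, Matrix.map_sub _ (map_sub _), hx, blockMatrix]
  congr 1
  ext ⟨u, i⟩ ⟨v, j⟩
  rw [map_apply, Matrix.sum_apply, Matrix.sum_apply, map_sum, Fintype.sum_prod_type]
  refine Finset.sum_congr rfl fun e _ => ?_
  simp only [cover, Matrix.smul_apply, Matrix.add_apply, smul_eq_mul, map_mul, map_add, mul_add,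
    Finset.sum_add_distrib, place, transpose_apply, signedPermMatrix, single_apply, Prod.mk.injEq]
  congr 1
  · rw [Finset.sum_eq_single i]
    · by_cases h1 : G.tail e = u <;> by_cases h2 : G.head e = v <;> by_cases h3 : σ e i = j <;>
        simp [h1, h2, h3, Ne.symm]
    · intro k _ hk
      simp [hk]
    · simp
  · rw [Finset.sum_eq_single j]
    · by_cases h1 : G.tail e = v <;> by_cases h2 : G.head e = u <;> by_cases h3 : σ e j = i <;>
        simp [h1, h2, h3, Ne.symm]
    · intro k _ hk
      simp [hk]
    · simp

/-- The average of the characteristic polynomials of all signed permutation coverings is the average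
of the matching polynomials of the permutation coverings. -/
theorem sum_det_signedPerm (G : OrientedGraph V E) (x : ℝ) :
    ∑ q : E → (Fin d → ℤˣ) × Equiv.Perm (Fin d), ((x : ℂ) • 1 - G.blockMatrix
        (fun e => signedPermMatrix (q e)) (fun e => (signedPermMatrix (q e))ᵀ)).det =
      ((∑ σ : E → Equiv.Perm (Fin d),
        (G.cover σ).signedSum x Finset.univ Finset.univ : ℝ) : ℂ) := by
  have hmask : ∀ M : Matrix (V × Fin d) (V × Fin d) ℝ, mask Finset.univ M = M := fun M => by
    ext; simp [mask]
  rw [← (Equiv.arrowProdEquivProdArrow E (fun _ => Fin d → ℤˣ)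
    (fun _ => Equiv.Perm (Fin d))).symm.sum_comp, Fintype.sum_prod_type_right, Complex.ofReal_sum]
  refine Finset.sum_congr rfl fun σ _ => ?_
  rw [signedSum, Complex.ofReal_sum, ← (Equiv.curry E (Fin d) ℤˣ).symm.sum_comp]
  refine Finset.sum_congr rfl fun ε _ => ?_
  rw [hmask]
  exact (congrArg det (G.map_signedMatrix_cover σ ε x).symm).trans
    (RingHom.map_det Complex.ofRealHom _).symm

/-- The average characteristic polynomial of a mixing covering is positive above `ρ(G)`. -/
theorem exists_sum_det_pos (G : OrientedGraph V E) (hconn : G.Connected) (hG : G.Loopless) (v₀ : V)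
    {Λ : Type*} [Fintype Λ] [Nonempty Λ] {B B' : Λ → Matrix (Fin d) (Fin d) ℂ} (h : IsMixing B B')
    {x : ℝ} (hx : G.rho v₀ < x) :
    ∃ r : ℝ, 0 < r ∧ ∑ γ : E → Λ, ((x : ℂ) • 1 - G.blockMatrix
      (fun e => B (γ e)) (fun e => B' (γ e))).det = r := by
  have key := h.pi_average_eq (signedPermMatrix.isMixing d)
    (fun X Y => ((x : ℂ) • 1 - G.blockMatrix (E := E) X Y).det) (fun e X Y => by
      -- The determinant of `x - A` is, up to this sign, that of `-x + A`.
      have := (coeffSpan d).smul_mem ((-1) ^ Fintype.card (V × Fin d))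
        (G.det_sub_blockMatrix_update_mem_coeffSpan hG (-((x : ℂ) • 1)) e X Y)
      refine (congrArg (· ∈ coeffSpan d) ?_).mp this
      funext A C
      rw [Pi.smul_apply, Pi.smul_apply, smul_eq_mul, ← det_neg]
      congr 1
      abel)
  rw [sum_det_signedPerm] at key
  have hpos : 0 < ∑ σ : E → Equiv.Perm (Fin d),
      (G.cover σ).signedSum x Finset.univ Finset.univ :=
    Finset.sum_pos (fun σ _ => G.signedSum_cover_pos hconn hG v₀ σ hx) Finset.univ_nonempty
  refine ⟨_, div_pos (mul_pos (Nat.cast_pos.2 (Fintype.card_pos (α := E → Λ))) hpos)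
    (Nat.cast_pos.2 (Fintype.card_pos (α := E → (Fin d → ℤˣ) × Equiv.Perm (Fin d)))), ?_⟩
  rw [Complex.ofReal_div, Complex.ofReal_mul, Complex.ofReal_natCast, Complex.ofReal_natCast,
    ← key, mul_div_cancel_left₀]
  exact Nat.cast_ne_zero.2 Fintype.card_ne_zero

end OrientedGraph

/-! ### Interlacing through the upper half plane -/

section

open Polynomial

namespace Polynomial

open Filter Topology

theorem aeval_ofReal_complex (p : ℝ[X]) (x : ℝ) : aeval (x : ℂ) p = ((p.eval x : ℝ) : ℂ) :=
  aeval_algebraMap_apply_eq_algebraMap_eval x p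

/-- If `q / p` maps the upper half plane to the lower one, then it is antitone on the half lines
where `p > 0`. -/
theorem antitoneOn_div_of_im_nonpos {p q : ℝ[X]} {a : ℝ} (hp : ∀ x, a < x → 0 < p.eval x)
    (him : ∀ z : ℂ, 0 < z.im → (aeval z q / aeval z p).im ≤ 0) :
    AntitoneOn (fun x => q.eval x / p.eval x) (Set.Ioi a) := by
  have hd : ∀ x, a < x → HasDerivAt (fun x => q.eval x / p.eval x)
      ((q.derivative.eval x * p.eval x - q.eval x * p.derivative.eval x) / p.eval x ^ 2) x :=
    fun x hx => (q.hasDerivAt x).div (p.hasDerivAt x) (hp x hx).ne'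
  refine antitoneOn_of_deriv_nonpos (convex_Ioi a)
    (fun x hx => (hd x hx).continuousAt.continuousWithinAt)
    (fun x hx => (hd x (by simpa using hx)).differentiableAt.differentiableWithinAt) fun x hx => ?_
  rw [interior_Ioi, Set.mem_Ioi] at hx
  rw [(hd x hx).deriv]
  set D := (q.derivative.eval x * p.eval x - q.eval x * p.derivative.eval x) / p.eval x ^ 2 with hD
  have hpx : aeval (x : ℂ) p ≠ 0 := by
    rw [aeval_ofReal_complex]; exact_mod_cast (hp x hx).ne'
  have hψ : HasDerivAt (fun z : ℂ => aeval z q / aeval z p) (D : ℂ) (x : ℂ) := by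
    have h1 := (q.hasDerivAt_aeval (x : ℂ)).fun_div (p.hasDerivAt_aeval (x : ℂ)) hpx
    rw [aeval_ofReal_complex, aeval_ofReal_complex, aeval_ofReal_complex,
      aeval_ofReal_complex] at h1
    rw [hD]
    push_cast
    exact h1
  -- The quotient is real at `x`, so `D` is the limit of its imaginary part at `x + iy` divided by
  -- `y`, as `y` decreases to zero.
  have hline : HasDerivAt (fun y : ℝ => (x : ℂ) + (y : ℂ) * Complex.I) Complex.I 0 := by
    have := ((Complex.ofRealCLM.hasDerivAt (x := (0 : ℝ))).mul_const Complex.I).const_add (x : ℂ)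
    simpa using this
  have hcomp : HasDerivAt (fun y : ℝ => aeval ((x : ℂ) + (y : ℂ) * Complex.I) q /
      aeval ((x : ℂ) + (y : ℂ) * Complex.I) p) ((D : ℂ) * Complex.I) 0 :=
    HasDerivAt.comp (h₂ := fun z : ℂ => aeval z q / aeval z p) (0 : ℝ) (by simpa using hψ) hline
  have him' : HasDerivAt (fun y : ℝ => (aeval ((x : ℂ) + (y : ℂ) * Complex.I) q /
      aeval ((x : ℂ) + (y : ℂ) * Complex.I) p).im) D 0 := by
    have := (Complex.imCLM.hasFDerivAt.comp_hasDerivAt (0 : ℝ) hcomp)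
    rw [show Complex.imCLM ((D : ℂ) * Complex.I) = D by simp] at this
    exact this
  have hslope := him'.hasDerivWithinAt (s := Set.Ioi 0)
  rw [hasDerivWithinAt_iff_tendsto_slope' (by simp)] at hslope
  refine le_of_tendsto hslope ?_
  filter_upwards [self_mem_nhdsWithin] with y hy
  have hy : 0 < y := hy
  have h0 : (aeval ((x : ℂ) + ((0 : ℝ) : ℂ) * Complex.I) q /
      aeval ((x : ℂ) + ((0 : ℝ) : ℂ) * Complex.I) p).im = 0 := by
    simp only [Complex.ofReal_zero, zero_mul, add_zero, aeval_ofReal_complex, ← Complex.ofReal_div,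
      Complex.ofReal_im]
  rw [slope_def_field, h0, sub_zero, sub_zero]
  exact div_nonpos_of_nonpos_of_nonneg (him _ (by simpa using hy)) hy.le

/-- The quotient is antitone and tends to zero at infinity. -/
theorem eval_nonneg_of_im_nonpos {p q : ℝ[X]} {a : ℝ} (hp : ∀ x, a < x → 0 < p.eval x)
    (hdeg : q.degree < p.degree)
    (him : ∀ z : ℂ, 0 < z.im → (aeval z q / aeval z p).im ≤ 0) {x : ℝ} (hx : a < x) :
    0 ≤ q.eval x := by
  have hanti := antitoneOn_div_of_im_nonpos hp him
  have hlim := q.div_tendsto_atTop_zero_of_degree_lt p hdeg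
  have : 0 ≤ q.eval x / p.eval x := by
    refine le_of_tendsto hlim ?_
    filter_upwards [eventually_ge_atTop x] with y hy
    exact hanti hx (hx.trans_le hy) hy
  have h2 := mul_nonneg this (hp x hx).le
  rwa [div_mul_cancel₀ _ (hp x hx).ne'] at h2

theorem Monic.exists_forall_eval_pos {p : ℝ[X]} (hp : p.Monic) :
    ∃ a : ℝ, ∀ x, a < x → 0 < p.eval x := by
  by_cases hd : 0 < p.degree
  · have := p.tendsto_atTop_of_leadingCoeff_nonneg hd (by rw [hp.leadingCoeff]; exact zero_le_one)
    obtain ⟨a, ha⟩ := eventually_atTop.1 (this.eventually_gt_atTop 0)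
    exact ⟨a, fun x hx => ha x hx.le⟩
  · have : p = 1 := (Monic.degree_le_zero_iff_eq_one hp).1 (not_lt.1 hd)
    exact ⟨0, fun x _ => by simp [this]⟩

/-- If all real combinations `p - t q` have no zeros in the upper half plane, then `q / p` maps it
to the lower half plane. -/
theorem im_div_neg_of_forall_ne_zero {p q : ℝ[X]} (hp : p.Monic) (hdeg : q.degree < p.degree)
    (hq : 0 < q.leadingCoeff)
    (hne : ∀ (t : ℝ) (z : ℂ), 0 < z.im → aeval z (p - C t * q) ≠ 0) (z : ℂ) (hz : 0 < z.im) :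
    (aeval z q / aeval z p).im < 0 := by
  have hp0 : ∀ z : ℂ, 0 < z.im → aeval z p ≠ 0 := fun z hz => by simpa using hne 0 z hz
  set ψ : ℂ → ℂ := fun z => aeval z q / aeval z p with hψ
  set U : Set ℂ := {z | 0 < z.im} with hU
  have hUo : IsOpen U := isOpen_lt continuous_const Complex.continuous_im
  have hUc : IsPreconnected U := (convex_halfSpace_im_gt 0).isPreconnected
  have hval : ∀ z ∈ U, ∀ t : ℝ, t ≠ 0 → ψ z ≠ (t : ℂ) := by
    intro z hz t ht h
    refine hne t⁻¹ z hz ?_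
    have h1 : aeval z q = t * aeval z p := (div_eq_iff (hp0 z hz)).1 h
    have ht' : (t : ℂ) ≠ 0 := by exact_mod_cast ht
    rw [map_sub, map_mul, aeval_C, h1, Complex.coe_algebraMap, Complex.ofReal_inv]
    field_simp
    ring
  have hana : AnalyticOnNhd ℂ ψ U := by
    refine DifferentiableOn.analyticOnNhd (fun z hz => ?_) hUo
    exact ((q.differentiable_aeval z).div (p.differentiable_aeval z)
      (hp0 z hz)).differentiableWithinAt
  have hreal : ∀ z ∈ U, (ψ z).im ≠ 0 := by
    intro z hz him
    -- Nonzero real values are excluded. A constant real quotient is then zero, against `hq`; a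
    -- nonconstant one is open, so the value zero would bring nonzero real values with it.
    rcases hana.is_constant_or_isOpen hUc with ⟨w, hw⟩ | hopen
    · have hw' : w = (w.re : ℂ) := by
        rw [hw z hz] at him
        exact Complex.ext (by simp) (by simpa using him)
      have hre : w.re = 0 := by
        by_contra h
        exact hval z hz _ h ((hw z hz).trans hw')
      have hzero : ∀ z ∈ U, aeval z q = 0 := by
        intro z hz
        have := hw z hz
        rw [hw', hre, Complex.ofReal_zero, hψ] at this
        exact (div_eq_zero_iff.1 this).resolve_right (hp0 z hz)
      have hq0 : q.map (algebraMap ℝ ℂ) = 0 := by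
        refine eq_zero_of_infinite_isRoot _ (Set.Infinite.mono (s := U) (fun z hz => ?_) ?_)
        · simpa [IsRoot, eval_map_algebraMap] using hzero z hz
        · exact infinite_of_mem_nhds Complex.I (hUo.mem_nhds (by simp [hU]))
      rw [Polynomial.map_eq_zero] at hq0
      rw [hq0] at hq
      simp at hq
    · have h0 : ψ z = 0 := by
        by_contra h
        refine hval z hz (ψ z).re (fun hre => h (Complex.ext (by simpa using hre)
          (by simpa using him))) (Complex.ext (by simp) (by simpa using him))
      have hopen' := hopen U subset_rfl hUo
      have hmem : (0 : ℂ) ∈ ψ '' U := ⟨z, hz, h0⟩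
      obtain ⟨ε, hε, hball⟩ := Metric.isOpen_iff.1 hopen' 0 hmem
      obtain ⟨z', hz', h'⟩ := hball (show ((ε / 2 : ℝ) : ℂ) ∈ Metric.ball (0 : ℂ) ε by
        rw [mem_ball_zero_iff, Complex.norm_real, Real.norm_of_nonneg (by positivity)]
        linarith)
      exact hval z' hz' (ε / 2) (by positivity) h'
  have hcont : ContinuousOn (fun z => (ψ z).im) U :=
    Complex.continuous_im.comp_continuousOn hana.continuousOn
  have hsign : (∀ z ∈ U, (ψ z).im < 0) ∨ ∀ z ∈ U, 0 < (ψ z).im := by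
    by_contra! h
    obtain ⟨⟨z1, hz1, h1⟩, z2, hz2, h2⟩ := h
    obtain ⟨z3, hz3, h3⟩ := hUc.intermediate_value hz2 hz1 hcont ⟨h2, h1⟩
    exact hreal z3 hz3 h3
  rcases hsign with h | h
  · exact h z hz
  -- With the opposite sign, `-q` would be nonnegative far to the right, against the positive
  -- leading coefficient of `q`.
  · exfalso
    obtain ⟨a, ha⟩ := hp.exists_forall_eval_pos
    have hnn : ∀ x, a < x → 0 ≤ (-q).eval x := fun x hx =>
      eval_nonneg_of_im_nonpos ha (by rwa [degree_neg]) (fun z hz => by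
        rw [map_neg, neg_div, Complex.neg_im]
        exact neg_nonpos.2 (h z hz).le) hx
    have hq0 : q ≠ 0 := by rintro rfl; simp at hq
    have hinf : q = 0 ∨ 0 < q.eval (a + 1) ∨ ∃ x, a < x ∧ 0 < q.eval x := by
      right; right
      have hm : (C q.leadingCoeff⁻¹ * q).Monic := by
        rw [mul_comm]; exact monic_mul_leadingCoeff_inv hq0
      obtain ⟨b, hb⟩ := hm.exists_forall_eval_pos
      refine ⟨max a b + 1, by have := le_max_left a b; linarith, ?_⟩
      have := hb (max a b + 1) (by have := le_max_right a b; linarith)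
      rw [eval_mul, eval_C] at this
      exact pos_of_mul_pos_right this (inv_nonneg.2 hq.le)
    rcases hinf with h' | h' | ⟨x, hx, h'⟩
    · exact hq0 h'
    · have := hnn (a + 1) (by linarith)
      rw [eval_neg] at this; linarith
    · have := hnn x hx
      rw [eval_neg] at this; linarith

/-- If `f₁ = p - q₁` and `f₂ = p - q₂` interlace the monic polynomial `p` on the same side and both
have a root above `l`, then so does their average. -/
theorem exists_root_average {p q₁ q₂ : ℝ[X]} (hp : p.Monic) (hd : 0 < p.degree)
    (h₁ : q₁.degree < p.degree) (h₂ : q₂.degree < p.degree)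
    (him₁ : ∀ z : ℂ, 0 < z.im → (aeval z q₁ / aeval z p).im ≤ 0)
    (him₂ : ∀ z : ℂ, 0 < z.im → (aeval z q₂ / aeval z p).im ≤ 0) {l : ℝ}
    (hr₁ : ∃ x, l < x ∧ (p - q₁).eval x = 0) (hr₂ : ∃ x, l < x ∧ (p - q₂).eval x = 0) :
    ∃ x, l < x ∧ (C (1 / 2) * ((p - q₁) + (p - q₂))).eval x = 0 := by
  set f := C (1 / 2) * ((p - q₁) + (p - q₂)) with hf
  -- At a point where both polynomials are nonpositive the average is too, and it is monic.
  suffices h : ∃ y, l < y ∧ (p - q₁).eval y ≤ 0 ∧ (p - q₂).eval y ≤ 0 by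
    obtain ⟨y, hy, h1, h2⟩ := h
    have hfy : f.eval y ≤ 0 := by
      rw [hf, eval_mul, eval_add, eval_C]; linarith
    have hfp : f = p - C (1 / 2) * (q₁ + q₂) := by
      have : (C (1 / 2) : ℝ[X]) * 2 = 1 := by
        rw [show (2 : ℝ[X]) = C 2 from rfl, ← C_mul]; norm_num
      rw [hf]
      linear_combination p * this
    have hdq : (C (1 / 2) * (q₁ + q₂)).degree < p.degree := by
      refine (degree_C_mul (by norm_num)).trans_lt ((degree_add_le _ _).trans_lt (max_lt h₁ h₂))
    have hfm : f.Monic := by rw [hfp]; exact hp.sub_of_left hdq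
    have hlim := f.tendsto_atTop_of_leadingCoeff_nonneg
      (by rw [hfp, degree_sub_eq_left_of_degree_lt hdq]; exact hd)
      (by rw [hfm.leadingCoeff]; exact zero_le_one)
    obtain ⟨b, hb, hyb⟩ := ((hlim.eventually_ge_atTop 0).and (eventually_ge_atTop y)).exists
    obtain ⟨x, hx, hx0⟩ := intermediate_value_Icc hyb f.continuous.continuousOn ⟨hfy, hb⟩
    exact ⟨x, hy.trans_le hx.1, hx0⟩
  -- If `p` has a root above `l`, its largest root will do. Otherwise `q₁ / p` and `q₂ / p` are
  -- antitone above `l` and equal to one at the given roots, and the smaller of those roots will do.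
  by_cases hroot : ∃ s, l < s ∧ p.eval s = 0
  · have hfin : (p.roots.toFinset).Nonempty := by
      obtain ⟨s, -, hs⟩ := hroot
      exact ⟨s, by simp [hp.ne_zero, hs]⟩
    obtain ⟨s₀, hs₀, hs₀'⟩ := hroot
    set s := p.roots.toFinset.max' hfin with hs
    have hmem : p.eval s = 0 := by
      have := p.roots.toFinset.max'_mem hfin
      rw [← hs] at this
      simpa [hp.ne_zero] using this
    have hpos : ∀ x, s < x → 0 < p.eval x := by
      intro x hx
      by_contra! hneg
      have hlim := p.tendsto_atTop_of_leadingCoeff_nonneg hd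
        (by rw [hp.leadingCoeff]; exact zero_le_one)
      obtain ⟨b, hb, hyb⟩ := ((hlim.eventually_ge_atTop 0).and (eventually_ge_atTop x)).exists
      obtain ⟨x', hx', hx0⟩ := intermediate_value_Icc hyb p.continuous.continuousOn ⟨hneg, hb⟩
      have := p.roots.toFinset.le_max' x' (by simpa [hp.ne_zero] using hx0)
      linarith [hx'.1]
    have hls : l < s := hs₀.trans_le (p.roots.toFinset.le_max' s₀ (by simp [hp.ne_zero, hs₀']))
    have key : ∀ q : ℝ[X], q.degree < p.degree →
        (∀ z : ℂ, 0 < z.im → (aeval z q / aeval z p).im ≤ 0) → (p - q).eval s ≤ 0 := by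
      intro q hq him
      have : 0 ≤ q.eval s := by
        refine ge_of_tendsto (q.continuous.continuousAt.tendsto.mono_left
          (nhdsWithin_le_nhds (s := Set.Ioi s))) ?_
        filter_upwards [self_mem_nhdsWithin] with x hx
        exact eval_nonneg_of_im_nonpos hpos hq him hx
      rw [eval_sub, hmem]; linarith
    exact ⟨s, hls, key q₁ h₁ him₁, key q₂ h₂ him₂⟩
  · push Not at hroot
    have hpos : ∀ x, l < x → 0 < p.eval x := by
      intro x hx
      by_contra! hneg
      have hlim := p.tendsto_atTop_of_leadingCoeff_nonneg hd
        (by rw [hp.leadingCoeff]; exact zero_le_one)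
      obtain ⟨b, hb, hyb⟩ := ((hlim.eventually_ge_atTop 0).and (eventually_ge_atTop x)).exists
      obtain ⟨x', hx', hx0⟩ := intermediate_value_Icc hyb p.continuous.continuousOn ⟨hneg, hb⟩
      exact hroot x' (hx.trans_le hx'.1) hx0
    obtain ⟨r₁, hl₁, hr₁⟩ := hr₁
    obtain ⟨r₂, hl₂, hr₂⟩ := hr₂
    have key : ∀ q : ℝ[X], (∀ z : ℂ, 0 < z.im → (aeval z q / aeval z p).im ≤ 0) →
        ∀ r y, l < y → y ≤ r → (p - q).eval r = 0 → (p - q).eval y ≤ 0 := by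
      intro q him r y hy hyr hr
      have hanti := antitoneOn_div_of_im_nonpos hpos him hy (hy.trans_le hyr) hyr
      have h1 : q.eval r / p.eval r = 1 := by
        rw [div_eq_one_iff_eq (hpos r (hy.trans_le hyr)).ne']
        rw [eval_sub] at hr; linarith
      simp only [h1] at hanti
      rw [one_le_div (hpos y hy)] at hanti
      rw [eval_sub]; linarith
    exact ⟨min r₁ r₂, lt_min hl₁ hl₂, key q₁ him₁ r₁ _ (lt_min hl₁ hl₂) (min_le_left _ _) hr₁,
      key q₂ him₂ r₂ _ (lt_min hl₁ hl₂) (min_le_right _ _) hr₂⟩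

end Polynomial

end

/-! ### Rank one perturbations of characteristic polynomials -/

section

open Polynomial

namespace Matrix

variable {N E : Type*} [Fintype N] [DecidableEq N]

/-- By a Schur complement, the perturbation moves into a single row of a bordered matrix, so the
determinant is affine in `t`. -/
theorem det_add_smul_vecMulVec {R : Type*} [CommRing R] (M : Matrix N N R) (u w : N → R) (t : R) :
    (M + t • vecMulVec u w).det = M.det + t * ((M + vecMulVec u w).det - M.det) := by
  have key : ∀ s : R, (M + s • vecMulVec u w).det =
      (fromBlocks M (replicateCol Unit u) 0 (1 : Matrix Unit Unit R)).det + s *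
        ((fromBlocks M (replicateCol Unit u) 0 (1 : Matrix Unit Unit R)).updateRow (Sum.inr ())
          (Sum.elim (-w) 0)).det := by
    intro s
    have h1 : fromBlocks M (replicateCol Unit u) (-(s • replicateRow Unit w)) 1 =
        (fromBlocks M (replicateCol Unit u) 0 (1 : Matrix Unit Unit R)).updateRow (Sum.inr ())
          ((fromBlocks M (replicateCol Unit u) 0 (1 : Matrix Unit Unit R)) (Sum.inr ()) +
            s • Sum.elim (-w) 0) := by
      ext (i | i) (j | j) <;> simp [updateRow_apply]
    have h2 : M + s • vecMulVec u w =
        M - replicateCol Unit u * (-(s • replicateRow Unit w)) := by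
      rw [vecMulVec_eq Unit]
      simp
    rw [h2, ← det_fromBlocks_one₂₂, h1, det_updateRow_add, updateRow_eq_self, det_updateRow_smul]
  have h0 := key 0
  have h1 := key 1
  rw [one_smul] at h1
  rw [zero_smul, add_zero] at h0
  rw [key t, h1, h0]
  ring

theorem charpoly_add_smul_vecMulVec {R : Type*} [CommRing R] (M : Matrix N N R) (u w : N → R)
    (t : R) : (M + t • vecMulVec u w).charpoly =
      M.charpoly + C t * ((M + vecMulVec u w).charpoly - M.charpoly) := by
  have h : ∀ s : R, (M + s • vecMulVec u w).charmatrix =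
      M.charmatrix + C s • vecMulVec (fun i => - C (u i)) (fun i => C (w i)) := by
    intro s
    ext1 i j
    simp only [charmatrix_apply, Matrix.add_apply, Matrix.smul_apply, vecMulVec_apply, smul_eq_mul,
      C_add, C_mul]
    ring
  have h1 := h 1
  rw [one_smul, C_1, one_smul] at h1
  rw [charpoly, h t, det_add_smul_vecMulVec, ← h1]
  rfl

/-- The characteristic polynomial of a hermitian matrix, with real coefficients. -/
noncomputable def realCharpoly (A : Matrix N N ℂ) : ℝ[X] :=
  open Classical in if h : A.IsHermitian then ∏ i, (X - C (h.eigenvalues i)) else 0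

theorem IsHermitian.map_realCharpoly {A : Matrix N N ℂ} (h : A.IsHermitian) :
    A.realCharpoly.map (algebraMap ℝ ℂ) = A.charpoly := by
  rw [realCharpoly, dif_pos h, h.charpoly_eq, Polynomial.map_prod]
  simp

theorem IsHermitian.monic_realCharpoly {A : Matrix N N ℂ} (h : A.IsHermitian) :
    A.realCharpoly.Monic := by
  rw [realCharpoly, dif_pos h]
  exact monic_prod_X_sub_C _ _

theorem IsHermitian.degree_realCharpoly {A : Matrix N N ℂ} (h : A.IsHermitian) :
    A.realCharpoly.degree = Fintype.card N := by
  rw [realCharpoly, dif_pos h, degree_prod]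
  simp

theorem IsHermitian.aeval_realCharpoly_ne_zero {A : Matrix N N ℂ} (h : A.IsHermitian) {z : ℂ}
    (hz : 0 < z.im) : aeval z A.realCharpoly ≠ 0 := by
  rw [realCharpoly, dif_pos h, map_prod, Finset.prod_ne_zero_iff]
  intro i _ h0
  have := congrArg Complex.im h0
  simp at this
  linarith

theorem isHermitian_vecMulVec_star (v : N → ℂ) : (vecMulVec v (star v)).IsHermitian := by
  rw [IsHermitian, conjTranspose_vecMulVec, star_star]

/-- The congruence by `1 + a bᴴ` changes a hermitian matrix by the difference of two positive
matrices of rank one. -/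
theorem exists_congruence_eq {H : Matrix N N ℂ} (hH : H.IsHermitian) (a b : N → ℂ) :
    ∃ v w : N → ℂ, (1 + vecMulVec a (star b)) * H * (1 + vecMulVec a (star b))ᴴ =
      H - vecMulVec w (star w) + vecMulVec v (star v) := by
  set β : ℂ := star b ⬝ᵥ (H *ᵥ b) with hβ
  have hβr : star β = β := by
    rw [hβ, ← star_dotProduct, star_mulVec, hH.eq, ← dotProduct_mulVec]
  have hrow : star b ᵥ* H = star (H *ᵥ b) := by rw [star_mulVec, hH.eq]
  -- As `β` is real, the congruence adds `a yᴴ + y aᴴ`, which polarizes into `v vᴴ - w wᴴ` with `v =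
  -- a + y/2` and `w = a - y/2`.
  set y : N → ℂ := H *ᵥ b + (β / 2) • a with hy
  have hexp : (1 + vecMulVec a (star b)) * H * (1 + vecMulVec a (star b))ᴴ =
      H + vecMulVec a (star (H *ᵥ b)) + vecMulVec (H *ᵥ b) (star a)
        + β • vecMulVec a (star a) := by
    rw [conjTranspose_add, conjTranspose_one, conjTranspose_vecMulVec, star_star, add_mul, one_mul,
      mul_add, mul_one, add_mul, mul_vecMulVec, vecMulVec_mul, vecMulVec_mul_vecMulVec, hrow,
      ← hrow, ← dotProduct_mulVec, ← hβ, vecMulVec_smul]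
    abel
  refine ⟨a + (1 / 2 : ℂ) • y, a - (1 / 2 : ℂ) • y, ?_⟩
  rw [hexp, hy]
  ext i j
  have h2 : star (β / 2) = β / 2 := by
    rw [star_div₀, hβr]; simp
  simp only [Matrix.add_apply, Matrix.sub_apply, Matrix.smul_apply, vecMulVec_apply, Pi.add_apply,
    Pi.sub_apply, Pi.smul_apply, Pi.star_apply, smul_eq_mul, star_add, star_sub, star_mul', h2]
  have h3 : star (1 / 2 : ℂ) = 1 / 2 := by simp
  rw [h3]
  ring

end Matrix

/-! ### Real-rooted families stable under averaging -/

open Matrix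

variable {N E : Type*} [Fintype N] [DecidableEq N] [DecidableEq E]

/-- A real polynomial attached to tuples of hermitian matrices that behaves under rank one
perturbations like the characteristic polynomial of their sum: it is monic, real rooted, and affine
along rank one directions, with a slope of the expected sign. -/
structure IsInterlacing (F : (E → Matrix N N ℂ) → ℝ[X]) : Prop where
  monic : ∀ H, (∀ e, (H e).IsHermitian) → (F H).Monic
  degree_eq : ∀ H, (∀ e, (H e).IsHermitian) → (F H).degree = Fintype.card N
  ne_zero : ∀ H, (∀ e, (H e).IsHermitian) → ∀ z : ℂ, 0 < z.im → aeval z (F H) ≠ 0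
  affine : ∀ H, (∀ e, (H e).IsHermitian) → ∀ e (v : N → ℂ), ∃ q : ℝ[X],
    q.degree < Fintype.card N ∧ (v ≠ 0 → 0 < q.coeff (Fintype.card N - 1)) ∧
    ∀ t : ℝ, F (H + Pi.single e ((t : ℂ) • vecMulVec v (star v))) = F H - C t * q

theorem isHermitian_add_single {H : E → Matrix N N ℂ} (hH : ∀ e, (H e).IsHermitian) (e : E)
    {A : Matrix N N ℂ} (hA : A.IsHermitian) (e' : E) :
    ((H + Pi.single e A : E → Matrix N N ℂ) e').IsHermitian := by
  rw [Pi.add_apply]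
  refine (hH e').add ?_
  by_cases h : e' = e
  · subst h; simpa using hA
  · simp [h]

theorem isHermitian_congruence {H : E → Matrix N N ℂ} (hH : ∀ e, (H e).IsHermitian)
    (R : E → Matrix N N ℂ) (e : E) : (R e * H e * (R e)ᴴ).IsHermitian :=
  isHermitian_mul_mul_conjTranspose _ (hH e)

namespace IsInterlacing

variable {F : (E → Matrix N N ℂ) → ℝ[X]}

/-- The whole line in the direction of the rank one matrix consists of polynomials without roots in
the upper half plane, which is what `im_div_neg_of_forall_ne_zero` requires. -/
theorem exists_sub [Nonempty N] (hF : IsInterlacing F) {H : E → Matrix N N ℂ}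
    (hH : ∀ e, (H e).IsHermitian) (e : E) (v : N → ℂ) :
    ∃ q : ℝ[X], q.degree < (F H).degree ∧
      F (H + Pi.single e (vecMulVec v (star v))) = F H - q ∧
      (q = 0 ∨ ∀ z : ℂ, 0 < z.im → (aeval z q / aeval z (F H)).im < 0) := by
  obtain ⟨q, hq, hpos, haff⟩ := hF.affine H hH e v
  refine ⟨q, by rwa [hF.degree_eq H hH], by simpa using haff 1, ?_⟩
  by_cases hv : v = 0
  · left
    have := haff 1
    simp only [hv, zero_vecMulVec, smul_zero, Pi.single_zero, add_zero, C_1, one_mul] at this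
    exact sub_eq_self.1 this.symm
  · right
    have hn : q.natDegree = Fintype.card N - 1 := by
      refine le_antisymm ?_ (le_natDegree_of_ne_zero (hpos hv).ne')
      have h1 : q ≠ 0 := by rintro rfl; simpa using hpos hv
      have := (natDegree_lt_iff_degree_lt h1).2 hq
      omega
    refine im_div_neg_of_forall_ne_zero (hF.monic H hH) (by rwa [hF.degree_eq H hH])
      (by rw [leadingCoeff, hn]; exact hpos hv) fun t z hz => ?_
    rw [← haff t]
    refine hF.ne_zero _ (isHermitian_add_single hH e ?_) z hz
    rw [IsHermitian, conjTranspose_smul, (isHermitian_vecMulVec_star v).eq]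
    exact congrArg (· • _) (Complex.conj_ofReal t)

/-- The two polynomials that are averaged have a common interlacing polynomial. -/
theorem exists_common [Nonempty N] (hF : IsInterlacing F) {H : E → Matrix N N ℂ}
    (hH : ∀ e, (H e).IsHermitian) (e : E) (a b : N → ℂ) (R : E → Matrix N N ℂ)
    (hR : R = Function.update (fun _ => 1) e (1 + vecMulVec a (star b))) :
    ∃ p q₁ q₂ : ℝ[X], p.Monic ∧ p.degree = Fintype.card N ∧ q₁.degree < p.degree ∧
      q₂.degree < p.degree ∧ F H = p - q₁ ∧ F (fun e => R e * H e * (R e)ᴴ) = p - q₂ ∧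
      (∀ z : ℂ, 0 < z.im → aeval z p ≠ 0) ∧
      (q₁ = 0 ∨ ∀ z : ℂ, 0 < z.im → (aeval z q₁ / aeval z p).im < 0) ∧
      (q₂ = 0 ∨ ∀ z : ℂ, 0 < z.im → (aeval z q₂ / aeval z p).im < 0) := by
  obtain ⟨v, w, hvw⟩ := exists_congruence_eq (hH e) a b
  -- Both tuples arise from `K` by adding a positive rank one matrix at `e`, so `F K` serves as the
  -- common `p`.
  set K : E → Matrix N N ℂ := H + Pi.single e (-vecMulVec w (star w)) with hK
  have hKh : ∀ e, (K e).IsHermitian :=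
    isHermitian_add_single hH e (isHermitian_vecMulVec_star w).neg
  obtain ⟨q₁, hd₁, h₁, him₁⟩ := hF.exists_sub hKh e w
  obtain ⟨q₂, hd₂, h₂, him₂⟩ := hF.exists_sub hKh e v
  refine ⟨F K, q₁, q₂, hF.monic K hKh, hF.degree_eq K hKh, hd₁, hd₂, ?_, ?_, hF.ne_zero K hKh,
    him₁, him₂⟩
  · rw [← h₁, hK, add_assoc, ← Pi.single_add]
    simp
  · rw [← h₂]
    congr 1
    funext e'
    by_cases he : e' = e
    · subst he
      simp only [hR, Function.update_self, hvw, hK, Pi.add_apply, Pi.single_eq_same]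
      abel
    · simp [hR, hK, he]

/-- Averaging over the identity and a congruence by an invertible matrix `1 + a bᴴ` preserves the
property. -/
theorem average [Nonempty N] (hF : IsInterlacing F) (e : E) (a b : N → ℂ)
    (R : E → Matrix N N ℂ) (hR : R = Function.update (fun _ => 1) e (1 + vecMulVec a (star b)))
    (hinv : IsUnit (1 + vecMulVec a (star b))) :
    IsInterlacing fun H => C (1 / 2) * (F H + F (fun e => R e * H e * (R e)ᴴ)) := by
  have hhalf : (C (1 / 2) : ℝ[X]) * 2 = 1 := by
    rw [show (2 : ℝ[X]) = C 2 from rfl, ← C_mul]; norm_num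
  have hform : ∀ H, (∀ e, (H e).IsHermitian) → ∃ p q : ℝ[X], p.Monic ∧
      p.degree = Fintype.card N ∧ q.degree < p.degree ∧
      C (1 / 2) * (F H + F (fun e => R e * H e * (R e)ᴴ)) = p - q := by
    intro H hH
    obtain ⟨p, q₁, q₂, hm, hd, hd₁, hd₂, h₁, h₂, -⟩ := hF.exists_common hH e a b R hR
    refine ⟨p, C (1 / 2) * (q₁ + q₂), hm, hd,
      (degree_C_mul (by norm_num)).trans_lt ((degree_add_le _ _).trans_lt (max_lt hd₁ hd₂)), ?_⟩
    rw [h₁, h₂]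
    linear_combination p * hhalf
  refine ⟨fun H hH => ?_, fun H hH => ?_, fun H hH z hz => ?_, fun H hH e' v => ?_⟩
  · obtain ⟨p, q, hm, -, hdq, h⟩ := hform H hH
    rw [h]
    exact hm.sub_of_left hdq
  · obtain ⟨p, q, -, hd, hdq, h⟩ := hform H hH
    rw [h, degree_sub_eq_left_of_degree_lt hdq, hd]
  · obtain ⟨p, q₁, q₂, -, -, -, -, h₁, h₂, hp0, him₁, him₂⟩ := hF.exists_common hH e a b R hR
    intro h0
    have hpz := hp0 z hz
    -- This is impossible: the left side is zero or has negative imaginary part.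
    have hsum : aeval z q₁ / aeval z p + aeval z q₂ / aeval z p = 2 := by
      rw [← add_div, div_eq_iff hpz]
      rw [h₁, h₂] at h0
      simp only [map_mul, map_add, map_sub, aeval_C, Complex.coe_algebraMap] at h0
      have h2 : ((1 / 2 : ℝ) : ℂ) ≠ 0 := by norm_num
      have h3 := (mul_eq_zero.1 h0).resolve_left h2
      linear_combination -h3
    have him := congrArg Complex.im hsum
    rw [Complex.add_im] at him
    rcases him₁ with rfl | him₁ <;> rcases him₂ with rfl | him₂
    · simp at hsum
    · have := him₂ z hz
      simp at him
      linarith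
    · have := him₁ z hz
      simp at him
      linarith
    · have h3 := him₁ z hz
      have h4 := him₂ z hz
      simp at him
      linarith
  -- The congruence carries the rank one direction of `v` to that of `R e' *ᵥ v`; invertibility
  -- keeps the slope strictly positive.
  · have hRv : v ≠ 0 → R e' *ᵥ v ≠ 0 := by
      intro hv
      by_cases he : e' = e
      · subst he
        rw [hR, Function.update_self]
        intro h0
        exact hv (mulVec_injective_of_isUnit hinv (by rw [h0, mulVec_zero]))
      · simpa [hR, he] using hv
    obtain ⟨q₁, hd₁, hp₁, ha₁⟩ := hF.affine H hH e' v
    obtain ⟨q₂, hd₂, hp₂, ha₂⟩ := hF.affine (fun e => R e * H e * (R e)ᴴ)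
      (isHermitian_congruence hH R) e' (R e' *ᵥ v)
    refine ⟨C (1 / 2) * (q₁ + q₂), (degree_C_mul (by norm_num)).trans_lt
      ((degree_add_le _ _).trans_lt (max_lt hd₁ hd₂)), fun hv => ?_, fun t => ?_⟩
    · rw [coeff_C_mul, coeff_add]
      have := hp₁ hv
      have := hp₂ (hRv hv)
      positivity
    · have hcomm : (fun e => R e * (H + Pi.single e' ((t : ℂ) • vecMulVec v (star v)) :
          E → Matrix N N ℂ) e * (R e)ᴴ) =
          (fun e => R e * H e * (R e)ᴴ) +
            Pi.single e' ((t : ℂ) • vecMulVec (R e' *ᵥ v) (star (R e' *ᵥ v))) := by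
        funext e''
        by_cases he : e'' = e'
        · subst he
          simp only [Pi.add_apply, Pi.single_eq_same, mul_add, add_mul]
          congr 1
          rw [mul_smul_comm, smul_mul_assoc, mul_vecMulVec, vecMulVec_mul, star_mulVec]
        · simp [he]
      rw [hcomm, ha₁, ha₂]
      ring

/-- If both averaged polynomials have a root above `l`, so does the average. -/
theorem exists_root_average [Nonempty N] (hF : IsInterlacing F) {H : E → Matrix N N ℂ}
    (hH : ∀ e, (H e).IsHermitian) (e : E) (a b : N → ℂ) (R : E → Matrix N N ℂ)
    (hR : R = Function.update (fun _ => 1) e (1 + vecMulVec a (star b))) {l : ℝ}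
    (h₁ : ∃ x, l < x ∧ (F H).eval x = 0)
    (h₂ : ∃ x, l < x ∧ (F (fun e => R e * H e * (R e)ᴴ)).eval x = 0) :
    ∃ x, l < x ∧ (C (1 / 2) * (F H + F (fun e => R e * H e * (R e)ᴴ))).eval x = 0 := by
  obtain ⟨p, q₁, q₂, hm, hd, hd₁, hd₂, e₁, e₂, -, him₁, him₂⟩ := hF.exists_common hH e a b R hR
  have hle : ∀ q : ℝ[X], (q = 0 ∨ ∀ z : ℂ, 0 < z.im → (aeval z q / aeval z p).im < 0) →
      ∀ z : ℂ, 0 < z.im → (aeval z q / aeval z p).im ≤ 0 := by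
    rintro q (rfl | h) z hz
    · simp
    · exact (h z hz).le
  rw [e₁] at h₁ ⊢
  rw [e₂] at h₂ ⊢
  exact Polynomial.exists_root_average hm (by rw [hd]; exact_mod_cast Fintype.card_pos) hd₁ hd₂
    (hle _ him₁) (hle _ him₂) h₁ h₂

open scoped ComplexOrder in
-- The starting point of the iteration. The top coefficient of the slope is the squared length of
-- `v`, read off from the trace.
theorem realCharpoly_sum [Nonempty N] [Fintype E] :
    IsInterlacing fun H : E → Matrix N N ℂ => (∑ e, H e).realCharpoly := by
  have hherm : ∀ H : E → Matrix N N ℂ, (∀ e, (H e).IsHermitian) → (∑ e, H e).IsHermitian := by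
    intro H hH
    rw [IsHermitian, conjTranspose_sum]
    exact Finset.sum_congr rfl fun e _ => hH e
  refine ⟨fun H hH => (hherm H hH).monic_realCharpoly,
    fun H hH => (hherm H hH).degree_realCharpoly,
    fun H hH z hz => (hherm H hH).aeval_realCharpoly_ne_zero hz, fun H hH e v => ?_⟩
  set A := ∑ e, H e with hA
  have hAh : A.IsHermitian := hherm H hH
  have hAt : ∀ t : ℝ, (A + (t : ℂ) • vecMulVec v (star v)).IsHermitian := by
    intro t
    refine hAh.add ?_
    rw [IsHermitian, conjTranspose_smul, (isHermitian_vecMulVec_star v).eq]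
    simp
  have hA1 : (A + vecMulVec v (star v)).IsHermitian := hAh.add (isHermitian_vecMulVec_star v)
  have hinj := Polynomial.map_injective (algebraMap ℝ ℂ) (algebraMap ℝ ℂ).injective
  refine ⟨A.realCharpoly - (A + vecMulVec v (star v)).realCharpoly, ?_, fun hv => ?_, fun t => ?_⟩
  · rw [← hAh.degree_realCharpoly]
    refine degree_sub_lt_left ?_ hAh.monic_realCharpoly.ne_zero ?_
    · rw [hAh.degree_realCharpoly, hA1.degree_realCharpoly]
    · rw [hAh.monic_realCharpoly.leadingCoeff, hA1.monic_realCharpoly.leadingCoeff]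
  · have h1 := trace_eq_neg_charpoly_coeff A
    have h2 := trace_eq_neg_charpoly_coeff (A + vecMulVec v (star v))
    rw [← hAh.map_realCharpoly, coeff_map] at h1
    rw [← hA1.map_realCharpoly, coeff_map, trace_add, trace_vecMulVec, h1] at h2
    have h3 : v ⬝ᵥ star v = ((A.realCharpoly - (A + vecMulVec v (star v)).realCharpoly).coeff
        (Fintype.card N - 1) : ℝ) := by
      rw [coeff_sub, Complex.ofReal_sub]
      rw [Complex.coe_algebraMap] at h2
      linear_combination h2
    have h4 : 0 < v ⬝ᵥ star v := by
      rw [dotProduct_comm]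
      exact dotProduct_star_self_pos_iff.2 hv
    rw [h3] at h4
    exact_mod_cast h4
  · apply hinj
    have hs : ∑ e', (H + Pi.single e ((t : ℂ) • vecMulVec v (star v)) : E → Matrix N N ℂ) e' =
        A + (t : ℂ) • vecMulVec v (star v) := by
      simp only [Pi.add_apply, Finset.sum_add_distrib, Finset.sum_pi_single', Finset.mem_univ,
        if_true, hA]
    rw [hs, (hAt t).map_realCharpoly, charpoly_add_smul_vecMulVec, Polynomial.map_sub,
      Polynomial.map_mul, Polynomial.map_sub, hAh.map_realCharpoly, hA1.map_realCharpoly, map_C]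
    rw [Complex.coe_algebraMap]
    ring

end IsInterlacing

end

/-! ### Lazy random products in a finite group -/

section

open Polynomial

section LazyAverage

variable {𝒢 : Type*} [Group 𝒢]

/-- The average of `f` over the random products of a subword of `L` and the argument, every letter
being kept with probability `1/2`. -/
noncomputable def lazyAverage (f : 𝒢 → ℝ) : List 𝒢 → 𝒢 → ℝ
  | [], γ => f γ
  | s :: L, γ => (1 / 2) * (lazyAverage f L γ + lazyAverage f L (s * γ))

theorem lazyAverage_append (f : 𝒢 → ℝ) (L₁ L₂ : List 𝒢) :
    lazyAverage f (L₁ ++ L₂) = lazyAverage (lazyAverage f L₂) L₁ := by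
  induction L₁ with
  | nil => rfl
  | cons s L ih => funext γ; simp only [List.cons_append, lazyAverage, ih]

theorem lazyAverage_const_add_mul (f : 𝒢 → ℝ) (L : List 𝒢) (a b : ℝ) (γ : 𝒢) :
    lazyAverage (fun γ => a + b * f γ) L γ = a + b * lazyAverage f L γ := by
  induction L generalizing γ with
  | nil => rfl
  | cons s L ih => simp only [lazyAverage, ih]; ring

theorem lazyAverage_nonneg {f : 𝒢 → ℝ} (hf : ∀ γ, 0 ≤ f γ) (L : List 𝒢) (γ : 𝒢) :
    0 ≤ lazyAverage f L γ := by
  induction L generalizing γ with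
  | nil => exact hf γ
  | cons s L ih =>
    have h1 := ih γ
    have h2 := ih (s * γ)
    rw [lazyAverage]; linarith

theorem lazyAverage_pos {f : 𝒢 → ℝ} (hf : ∀ γ, 0 < f γ) (L : List 𝒢) (γ : 𝒢) :
    0 < lazyAverage f L γ := by
  induction L generalizing γ with
  | nil => exact hf γ
  | cons s L ih =>
    have h1 := ih γ
    have h2 := ih (s * γ)
    rw [lazyAverage]; linarith

/-- The empty subword has this probability. -/
theorem half_pow_mul_le_lazyAverage {f : 𝒢 → ℝ} (hf : ∀ γ, 0 ≤ f γ) (L : List 𝒢) (γ : 𝒢) :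
    (1 / 2) ^ L.length * f γ ≤ lazyAverage f L γ := by
  induction L generalizing γ with
  | nil => simp [lazyAverage]
  | cons s L ih =>
    have h1 := ih γ
    have h2 := lazyAverage_nonneg hf L (s * γ)
    rw [lazyAverage, List.length_cons, pow_succ]; linarith

theorem sum_lazyAverage [Fintype 𝒢] (f : 𝒢 → ℝ) (L : List 𝒢) :
    ∑ γ, lazyAverage f L γ = ∑ γ, f γ := by
  induction L with
  | nil => rfl
  | cons s L ih =>
    simp only [lazyAverage]
    rw [← Finset.mul_sum, Finset.sum_add_distrib, sum_mul_left_eq_sum s (lazyAverage f L), ih]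
    ring

/-- With positive probability a word spelling `h` is kept entirely. The first letter acts first, so
in a product the word of the right factor comes first. -/
theorem exists_lazyAverage_ge_of_mem_closure {S : Set 𝒢} {h : 𝒢} (hh : h ∈ Submonoid.closure S) :
    ∃ L : List 𝒢, (∀ s ∈ L, s ∈ S) ∧ ∃ c : ℝ, 0 < c ∧
      ∀ f : 𝒢 → ℝ, (∀ γ, 0 ≤ f γ) → ∀ γ, c * f (h * γ) ≤ lazyAverage f L γ := by
  induction hh using Submonoid.closure_induction with
  | mem s hs =>
    refine ⟨[s], by simpa using hs, 1 / 2, by norm_num, fun f hf γ => ?_⟩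
    have := hf γ
    simp only [lazyAverage]; linarith
  | one => exact ⟨[], by simp, 1, one_pos, fun f hf γ => by simp [lazyAverage]⟩
  | mul x y _ _ hx hy =>
    obtain ⟨L₁, hL₁, c₁, hc₁, h₁⟩ := hx
    obtain ⟨L₂, hL₂, c₂, hc₂, h₂⟩ := hy
    refine ⟨L₂ ++ L₁, fun s hs => (List.mem_append.1 hs).elim (hL₂ s) (hL₁ s), c₂ * c₁,
      mul_pos hc₂ hc₁, fun f hf γ => ?_⟩
    rw [lazyAverage_append, mul_assoc, mul_assoc]
    exact (mul_le_mul_of_nonneg_left (h₁ f hf (y * γ)) hc₂.le).trans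
      (h₂ _ (lazyAverage_nonneg hf L₁) γ)

/-- A Doeblin condition: one word whose lazy products reach every element with probability at least
`c`. Inverses of generators are not needed in a finite group. -/
theorem exists_lazyAverage_ge [Fintype 𝒢] {S : Set 𝒢} (hS : Subgroup.closure S = ⊤) :
    ∃ L : List 𝒢, (∀ s ∈ L, s ∈ S) ∧ ∃ c : ℝ, 0 < c ∧
      ∀ f : 𝒢 → ℝ, (∀ γ, 0 ≤ f γ) → ∀ γ γ', c * f γ' ≤ lazyAverage f L γ := by
  classical
  have key : ∀ A : Finset 𝒢, ∃ L : List 𝒢, (∀ s ∈ L, s ∈ S) ∧ ∃ c : ℝ, 0 < c ∧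
      ∀ f : 𝒢 → ℝ, (∀ γ, 0 ≤ f γ) → ∀ γ, ∀ h ∈ A, c * f (h * γ) ≤ lazyAverage f L γ := by
    intro A
    induction A using Finset.induction_on with
    | empty => exact ⟨[], by simp, 1, one_pos, by simp⟩
    | insert x A _ ih =>
      obtain ⟨L₁, hL₁, c₁, hc₁, h₁⟩ := ih
      have hx : x ∈ Submonoid.closure S := by
        rw [← Subgroup.closure_toSubmonoid_of_finite, hS]; trivial
      obtain ⟨L₂, hL₂, c₂, hc₂, h₂⟩ := exists_lazyAverage_ge_of_mem_closure hx
      refine ⟨L₂ ++ L₁, fun s hs => (List.mem_append.1 hs).elim (hL₂ s) (hL₁ s),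
        min (c₂ * (1 / 2) ^ L₁.length) ((1 / 2) ^ L₂.length * c₁), by positivity,
        fun f hf γ h hh => ?_⟩
      have hnn := lazyAverage_nonneg hf L₁
      rw [lazyAverage_append]
      rcases Finset.mem_insert.1 hh with rfl | hh
      · calc _ ≤ c₂ * (1 / 2) ^ L₁.length * f (h * γ) :=
              mul_le_mul_of_nonneg_right (min_le_left _ _) (hf _)
          _ = c₂ * ((1 / 2) ^ L₁.length * f (h * γ)) := mul_assoc _ _ _
          _ ≤ c₂ * lazyAverage f L₁ (h * γ) :=
              mul_le_mul_of_nonneg_left (half_pow_mul_le_lazyAverage hf L₁ _) hc₂.le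
          _ ≤ _ := h₂ _ hnn γ
      · calc _ ≤ (1 / 2) ^ L₂.length * c₁ * f (h * γ) :=
              mul_le_mul_of_nonneg_right (min_le_right _ _) (hf _)
          _ = (1 / 2) ^ L₂.length * (c₁ * f (h * γ)) := mul_assoc _ _ _
          _ ≤ (1 / 2) ^ L₂.length * lazyAverage f L₁ γ :=
              mul_le_mul_of_nonneg_left (h₁ f hf γ h hh) (by positivity)
          _ ≤ _ := half_pow_mul_le_lazyAverage hnn L₂ γ
  obtain ⟨L, hL, c, hc, h⟩ := key Finset.univ
  refine ⟨L, hL, c, hc, fun f hf γ γ' => ?_⟩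
  simpa using h f hf γ (γ' * γ⁻¹) (Finset.mem_univ _)

/-- Lazy random products of generators of a finite group equidistribute. -/
theorem exists_abs_lazyAverage_sub_le [Fintype 𝒢] {S : Set 𝒢} (hS : Subgroup.closure S = ⊤) {η : ℝ}
    (hη : 0 < η) : ∃ L : List 𝒢, (∀ s ∈ L, s ∈ S) ∧ ∀ (f : 𝒢 → ℝ) (m C : ℝ),
      ∑ γ, f γ = Fintype.card 𝒢 * m → (∀ γ, |f γ - m| ≤ C) →
        ∀ γ, |lazyAverage f L γ - m| ≤ η * C := by
  obtain ⟨L, hL, c, hc, hLc⟩ := exists_lazyAverage_ge hS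
  set ε := min c (1 / 2) with hε
  have hε0 : 0 < ε := by positivity
  have hε1 : ε ≤ 1 / 2 := min_le_right _ _
  have hcard : (0 : ℝ) < Fintype.card 𝒢 := Nat.cast_pos.2 Fintype.card_pos
  have hmean : ∀ (f : 𝒢 → ℝ) (m : ℝ), (∀ γ, 0 ≤ f γ) → ∑ γ, f γ = Fintype.card 𝒢 * m →
      ∀ γ, ε * m ≤ lazyAverage f L γ := by
    intro f m hf hm γ
    have h1 : ∑ γ' : 𝒢, ε * f γ' ≤ ∑ _γ' : 𝒢, lazyAverage f L γ :=
      Finset.sum_le_sum fun γ' _ =>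
        (mul_le_mul_of_nonneg_right (min_le_left _ _) (hf γ')).trans (hLc f hf γ γ')
    rw [← Finset.mul_sum, hm, Finset.sum_const, Finset.card_univ, nsmul_eq_mul] at h1
    exact le_of_mul_le_mul_left (by linarith) hcard
  -- The lower bound is applied to `C - m + f` and `C + m - f`, both nonnegative with mean `C`.
  have hcontract : ∀ (f : 𝒢 → ℝ) (m C : ℝ), ∑ γ, f γ = Fintype.card 𝒢 * m →
      (∀ γ, |f γ - m| ≤ C) → ∀ γ, |lazyAverage f L γ - m| ≤ (1 - ε) * C := by
    intro f m C hm hC γ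
    have h1 := hmean (fun γ => (C - m) + 1 * f γ) C (fun γ => by
      have := (abs_le.1 (hC γ)).1; linarith) (by
      rw [Finset.sum_add_distrib, ← Finset.mul_sum, hm, Finset.sum_const, Finset.card_univ,
        nsmul_eq_mul]; ring) γ
    have h2 := hmean (fun γ => (C + m) + (-1) * f γ) C (fun γ => by
      have := (abs_le.1 (hC γ)).2; linarith) (by
      rw [Finset.sum_add_distrib, ← Finset.mul_sum, hm, Finset.sum_const, Finset.card_univ,
        nsmul_eq_mul]; ring) γ
    rw [lazyAverage_const_add_mul] at h1 h2
    rw [abs_le]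
    constructor <;> linarith
  have hiter : ∀ n : ℕ, ∃ L' : List 𝒢, (∀ s ∈ L', s ∈ S) ∧ ∀ (f : 𝒢 → ℝ) (m C : ℝ),
      ∑ γ, f γ = Fintype.card 𝒢 * m → (∀ γ, |f γ - m| ≤ C) →
        ∀ γ, |lazyAverage f L' γ - m| ≤ (1 - ε) ^ n * C := by
    intro n
    induction n with
    | zero => exact ⟨[], by simp, fun f m C _ hC γ => by simpa [lazyAverage] using hC γ⟩
    | succ n ih =>
      obtain ⟨L', hL', h'⟩ := ih
      refine ⟨L ++ L', fun s hs => (List.mem_append.1 hs).elim (hL s) (hL' s),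
        fun f m C hm hC γ => ?_⟩
      rw [lazyAverage_append, pow_succ', mul_assoc]
      exact hcontract _ m _ (by rw [sum_lazyAverage, hm]) (h' f m C hm hC) γ
  obtain ⟨n, hn⟩ := exists_pow_lt_of_lt_one hη (show 1 - ε < 1 by linarith)
  obtain ⟨L', hL', h'⟩ := hiter n
  refine ⟨L', hL', fun f m C hm hC γ => (h' f m C hm hC γ).trans ?_⟩
  have hC0 : 0 ≤ C := (abs_nonneg _).trans (hC 1)
  exact mul_le_mul_of_nonneg_right hn.le hC0

/-- If the property of having a root above `l` passes to lazy averages, then some member of the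
family has no root above the largest root of the average over the group. -/
theorem exists_forall_eval_ne_zero [Fintype 𝒢] {S : Set 𝒢} (hS : Subgroup.closure S = ⊤)
    (f : 𝒢 → ℝ[X]) (hmonic : ∀ γ, (f γ).Monic)
    (hroot : ∀ l : ℝ, (∀ γ, ∃ x, l < x ∧ (f γ).eval x = 0) → ∀ L : List 𝒢, (∀ s ∈ L, s ∈ S) →
      ∃ x, l < x ∧ lazyAverage (fun γ => (f γ).eval x) L 1 = 0) {l : ℝ}
    (hpos : ∀ x, l < x → 0 < ∑ γ, (f γ).eval x) :
    ∃ γ, ∀ x, l < x → (f γ).eval x ≠ 0 := by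
  by_contra! hcon
  choose r hr hr0 using hcon
  obtain ⟨γ₀, hγ₀⟩ := Finite.exists_min r
  -- Moving up from `l` to `l'` gives a compact interval on which the mean has a positive minimum;
  -- all chosen roots still lie above `l'`.
  obtain ⟨l', hl', hl'r⟩ := exists_between (hr γ₀)
  have hroots := hroot l' fun γ => ⟨r γ, hl'r.trans_le (hγ₀ γ), hr0 γ⟩
  choose a ha using fun γ => (hmonic γ).exists_forall_eval_pos
  obtain ⟨γ₁, hγ₁⟩ := Finite.exists_max a
  -- Beyond `M` all members are positive, hence so is every lazy average.
  set M := max (a γ₁) l' with hM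
  have hcard : (0 : ℝ) < Fintype.card 𝒢 := Nat.cast_pos.2 Fintype.card_pos
  set m : ℝ → ℝ := fun x => (∑ γ, (f γ).eval x) / Fintype.card 𝒢 with hm
  have hmc : Continuous m :=
    (continuous_finsetSum _ fun γ _ => (f γ).continuous).div_const _
  have hne : (Set.Icc l' M).Nonempty := Set.nonempty_Icc.2 (le_max_right _ _)
  obtain ⟨x₀, hx₀, hmin⟩ := isCompact_Icc.exists_isMinOn hne hmc.continuousOn
  have hδ : 0 < m x₀ := div_pos (hpos x₀ (hl'.trans_le hx₀.1)) hcard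
  have hbdd : ∀ γ, ∃ C, ∀ x ∈ Set.Icc l' M, |(f γ).eval x - m x| ≤ C := fun γ => by
    obtain ⟨C, hC⟩ := isCompact_Icc.exists_bound_of_continuousOn
      ((f γ).continuous.sub hmc).continuousOn (s := Set.Icc l' M)
    exact ⟨C, fun x hx => by simpa using hC x hx⟩
  choose C hC using hbdd
  obtain ⟨γ₂, hγ₂⟩ := Finite.exists_max C
  set K := |C γ₂| + 1 with hK
  have hK0 : 0 < K := by positivity
  -- The root `x` depends on `L`, so the error must be at most half the minimum `m x₀` uniformly in
  -- `x`.
  obtain ⟨L, hL, hLη⟩ := exists_abs_lazyAverage_sub_le hS (η := m x₀ / (2 * K)) (by positivity)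
  obtain ⟨x, hx, hx0⟩ := hroots L hL
  by_cases hxM : x ≤ M
  · have h1 := hLη (fun γ => (f γ).eval x) (m x) K
      (by rw [hm]; field_simp) (fun γ => (hC γ x ⟨hx.le, hxM⟩).trans
        ((hγ₂ γ).trans ((le_abs_self _).trans (by linarith)))) 1
    rw [hx0, zero_sub, abs_neg] at h1
    have h2 : m x₀ ≤ m x := hmin ⟨hx.le, hxM⟩
    have h3 : m x₀ / (2 * K) * K = m x₀ / 2 := by field_simp
    rw [h3] at h1
    have := le_abs_self (m x)
    linarith
  · refine (lazyAverage_pos (fun γ => ha γ x ?_) L 1).ne' hx0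
    exact (hγ₁ γ).trans_lt ((le_max_left _ _).trans_lt (not_le.1 hxM))

end LazyAverage

end

/-! ### Unitarization -/

section Unitarization

open scoped Matrix ComplexOrder MatrixOrder

/-- Every complex representation of a finite group is equivalent to a unitary one. -/
theorem exists_conj_conjTranspose_eq {Γ : Type*} [Group Γ] [Fintype Γ] {d : ℕ}
    (π : Γ →* GL (Fin d) ℂ) : ∃ P : GL (Fin d) ℂ, ∀ g : Γ,
      ((P * π g * P⁻¹ : GL (Fin d) ℂ) : Matrix (Fin d) (Fin d) ℂ)ᴴ =
        ((P * π g⁻¹ * P⁻¹ : GL (Fin d) ℂ) : Matrix (Fin d) (Fin d) ℂ) := by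
  -- An invariant positive definite form; writing it as `Pᴴ P` gives the conjugating matrix.
  set Q : Matrix (Fin d) (Fin d) ℂ := ∑ g, (π g : Matrix (Fin d) (Fin d) ℂ)ᴴ * π g with hQ
  have hpos : Q.PosDef := Matrix.posDef_sum Finset.univ_nonempty fun g _ =>
    Matrix.PosDef.conjTranspose_mul_self _ (Matrix.mulVec_injective_of_isUnit (π g).isUnit)
  obtain ⟨A, hA⟩ := CStarAlgebra.nonneg_iff_eq_star_mul_self.mp hpos.posSemidef.nonneg
  rw [Matrix.star_eq_conjTranspose] at hA
  have hAu : IsUnit A := by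
    have := hpos.isUnit
    rw [hA, Matrix.isUnit_iff_isUnit_det, Matrix.det_mul] at this
    exact (Matrix.isUnit_iff_isUnit_det _).2 (isUnit_of_mul_isUnit_right this)
  obtain ⟨P, rfl⟩ := hAu
  have hinv : ∀ g : Γ, (π g : Matrix (Fin d) (Fin d) ℂ)ᴴ * Q * π g = Q := by
    intro g
    rw [hQ, Finset.mul_sum, Finset.sum_mul]
    conv_rhs => rw [← Equiv.sum_comp (Equiv.mulRight g)]
    refine Finset.sum_congr rfl fun h _ => ?_
    simp [Matrix.conjTranspose_mul, mul_assoc]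
  refine ⟨P, fun g => ?_⟩
  have h1 : ((P * π g * P⁻¹ : GL (Fin d) ℂ) : Matrix (Fin d) (Fin d) ℂ)ᴴ *
      (P * π g * P⁻¹ : GL (Fin d) ℂ) = 1 := by
    have h2 : (P.val * P⁻¹.val) = 1 := P.mul_inv
    calc _ = (P⁻¹.val)ᴴ * ((π g : Matrix (Fin d) (Fin d) ℂ)ᴴ *
          ((P.val)ᴴ * P.val) * π g) * P⁻¹.val := by
            simp only [Units.val_mul, Matrix.conjTranspose_mul, mul_assoc]
      _ = (P.val * P⁻¹.val)ᴴ *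
          (P.val * P⁻¹.val) := by
            rw [← hA, hinv, hA]
            simp only [Matrix.conjTranspose_mul, mul_assoc]
      _ = 1 := by rw [h2]; simp
  have h3 : (P * π g * P⁻¹) * (P * π g⁻¹ * P⁻¹) = 1 := by simp [mul_assoc]
  exact left_inv_eq_right_inv h1 (by rw [← Units.val_mul, h3, Units.val_one])

end Unitarization

/-! ### Block calculus for edge matrices -/

namespace Matrix

theorem exists_eq_vecMulVec_of_rank_le_one {m n K : Type*} [Fintype m] [Fintype n] [DecidableEq n]
    [Field K] {A : Matrix m n K} (hA : A.rank ≤ 1) :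
    ∃ (c : m → K) (b : n → K), A = vecMulVec c b := by
  obtain ⟨v, hv⟩ := finrank_le_one_iff.1 hA
  choose b hb using fun j => hv ⟨A *ᵥ Pi.single j 1, _, rfl⟩
  refine ⟨v, b, ?_⟩
  ext i j
  have := congrFun (congrArg Subtype.val (hb j)) i
  simp at this
  rw [vecMulVec_apply, ← this, mul_comm]

variable {V : Type*} [DecidableEq V] {d : ℕ}

open scoped Kronecker

theorem place_eq_kronecker (u v : V) (X : Matrix (Fin d) (Fin d) ℂ) :
    place u v X = single u v (1 : ℂ) ⊗ₖ X := by
  ext p q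
  simp [place, single_apply, eq_comm]

theorem conjTranspose_place (u v : V) (X : Matrix (Fin d) (Fin d) ℂ) :
    (place u v X)ᴴ = place v u Xᴴ := by
  rw [place_eq_kronecker, place_eq_kronecker, conjTranspose_kronecker, conjTranspose_single,
    star_one]

theorem place_vecMulVec (u : V) (c b : Fin d → ℂ) :
    place u u (vecMulVec c b) = vecMulVec (blockInclusion d u c) (blockInclusion d u b) := by
  ext p q
  by_cases h : p.1 = u <;> by_cases h' : q.1 = u <;>
    simp [place, blockInclusion, vecMulVec_apply, h, h']

theorem star_blockInclusion (u : V) (b : Fin d → ℂ) :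
    star (blockInclusion d u b) = blockInclusion d u (star b) := by
  funext p
  by_cases h : p.1 = u <;> simp [blockInclusion, h]

variable [Fintype V]

theorem place_mul_place (u v w : V) (X Y : Matrix (Fin d) (Fin d) ℂ) :
    place u v X * place v w Y = place u w (X * Y) := by
  simp only [place_eq_kronecker]
  rw [← mul_kronecker_mul, single_mul_single_same, one_mul]

theorem place_mul_place_of_ne (u : V) {v v' : V} (h : v ≠ v') (w : V)
    (X Y : Matrix (Fin d) (Fin d) ℂ) : place u v X * place v' w Y = 0 := by
  simp only [place_eq_kronecker]
  rw [← mul_kronecker_mul, single_mul_single_of_ne _ _ _ _ h, zero_kronecker]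

theorem one_add_place_mul_place (u w : V) (X Y : Matrix (Fin d) (Fin d) ℂ) :
    (1 + place u u (X - 1)) * place u w Y = place u w (X * Y) := by
  rw [add_mul, one_mul, place_mul_place, place_eq_kronecker, place_eq_kronecker, ← kronecker_add,
    ← place_eq_kronecker]
  congr 1
  noncomm_ring

theorem one_add_place_mul_place_of_ne {u v : V} (h : u ≠ v) (w : V)
    (X Y : Matrix (Fin d) (Fin d) ℂ) : (1 + place u u (X - 1)) * place v w Y = place v w Y := by
  rw [add_mul, one_mul, place_mul_place_of_ne _ h, add_zero]

theorem one_add_place_mul_one_add_place (u : V) (X Y : Matrix (Fin d) (Fin d) ℂ) :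
    (1 + place u u (X - 1)) * (1 + place u u (Y - 1)) = 1 + place u u (X * Y - 1) := by
  rw [mul_add, mul_one, one_add_place_mul_place, add_assoc]
  simp only [place_eq_kronecker, ← kronecker_add]
  congr 2
  noncomm_ring

/-- Multiplying a label by `g` is a congruence that acts in the block `u` only. On a loop, `g` would
act on both sides. -/
theorem one_add_place_congruence {u v : V} (h : u ≠ v) (g X : Matrix (Fin d) (Fin d) ℂ) :
    (1 + place u u (g - 1)) * (place u v X + place v u Xᴴ) * (1 + place u u (g - 1))ᴴ =
      place u v (g * X) + place v u (g * X)ᴴ := by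
  have h1 : ∀ Y, place v u Y * (1 + place u u (g - 1))ᴴ = place v u (Y * gᴴ) := fun Y => by
    have := congrArg conjTranspose (one_add_place_mul_place u v g Yᴴ)
    simpa only [conjTranspose_mul, conjTranspose_place, conjTranspose_conjTranspose] using this
  have h2 : ∀ Y, place u v Y * (1 + place u u (g - 1))ᴴ = place u v Y := fun Y => by
    have := congrArg conjTranspose (one_add_place_mul_place_of_ne h u g Yᴴ)
    simpa only [conjTranspose_mul, conjTranspose_place, conjTranspose_conjTranspose] using this
  rw [mul_add, one_add_place_mul_place, one_add_place_mul_place_of_ne h, add_mul, h1, h2,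
    conjTranspose_mul]

end Matrix

namespace OrientedGraph

open Matrix
open scoped Kronecker

variable {V E : Type*} [Fintype V] [DecidableEq V] [Fintype E] {d : ℕ}

/-- The two matrices are similar through the Kronecker product of the identity with `P`, so
unitarizing does not change the spectrum. -/
theorem charpoly_blockMatrix_conj (G : OrientedGraph V E) (P : GL (Fin d) ℂ)
    (X Y : E → Matrix (Fin d) (Fin d) ℂ) :
    (G.blockMatrix (fun e => P.val * X e * P⁻¹.val)
      fun e => P.val * Y e * P⁻¹.val).charpoly = (G.blockMatrix X Y).charpoly := by
  have hplace : ∀ (u v : V) (Z : Matrix (Fin d) (Fin d) ℂ),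
      place u v (P.val * Z * P⁻¹.val) = ((1 : Matrix V V ℂ) ⊗ₖ P.val) *
        (place u v Z * ((1 : Matrix V V ℂ) ⊗ₖ P⁻¹.val)) := by
    intro u v Z
    simp only [place_eq_kronecker]
    rw [← mul_kronecker_mul, ← mul_kronecker_mul, one_mul, mul_one, mul_assoc]
  have h : G.blockMatrix (fun e => P.val * X e * P⁻¹.val)
      (fun e => P.val * Y e * P⁻¹.val) = ((1 : Matrix V V ℂ) ⊗ₖ P.val) *
        (G.blockMatrix X Y * ((1 : Matrix V V ℂ) ⊗ₖ P⁻¹.val)) := by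
    simp only [blockMatrix, hplace, Finset.sum_mul, Finset.mul_sum, add_mul, mul_add]
  rw [h, charpoly_mul_comm, mul_assoc, ← mul_kronecker_mul, one_mul, P.inv_mul, one_kronecker_one,
    mul_one]

/-- The labeling with prescribed values on the chosen orientations. -/
def Labeling.ofEdges (G : OrientedGraph V E) {Γ : Type*} [Group Γ] (γ : E → Γ) : G.Labeling Γ :=
  ⟨Sum.elim γ fun e => (γ e)⁻¹, by rintro (e | e) <;> simp⟩

theorem coveringMatrix_ofEdges (G : OrientedGraph V E) {Γ : Type*} [Group Γ]
    (π : Γ →* GL (Fin d) ℂ) (γ : E → Γ) :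
    G.coveringMatrix π (Labeling.ofEdges G γ) =
      G.blockMatrix (fun e => (π (γ e) : Matrix _ _ ℂ)) fun e => (π (γ e)⁻¹ : Matrix _ _ ℂ) := by
  ext p q
  rw [coveringMatrix, Finset.sum_filter, Fintype.sum_sum_type, blockMatrix, Matrix.sum_apply,
    ← Finset.sum_add_distrib]
  refine Finset.sum_congr rfl fun e _ => ?_
  simp [place, h, t, Labeling.ofEdges, eq_comm]

end OrientedGraph

/-! ### From pseudo-reflections to lazy averages of labelings -/

section

open Matrix

theorem Subgroup.closure_mulSingle_eq_top {E Γ : Type*} [Finite E] [DecidableEq E] [Group Γ]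
    {S : Set Γ} (hS : Subgroup.closure S = ⊤) :
    Subgroup.closure {s : E → Γ | ∃ e, ∃ g ∈ S, s = Pi.mulSingle e g} = ⊤ := by
  refine eq_top_iff.2 fun x _ => Subgroup.pi_mem_of_mulSingle_mem x fun e => ?_
  have h : Subgroup.closure S ≤ (Subgroup.closure
      {s : E → Γ | ∃ e, ∃ g ∈ S, s = Pi.mulSingle e g}).comap (MonoidHom.mulSingle _ e) :=
    (Subgroup.closure_le _).2 fun g hg => Subgroup.subset_closure ⟨e, g, hg, rfl⟩
  exact h (hS ▸ Subgroup.mem_top (x e))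

/-- The set contains the preimages of the pseudo-reflections, rank at most one being invariant under
conjugation, and also the kernel of `π`, with `c = b = 0`. Together these generate `Γ` even if `π`
is not faithful. -/
theorem PropertyP2.closure_eq_top {Γ : Type*} [Group Γ] {d : ℕ} {π : Γ →* GL (Fin d) ℂ}
    (h : PropertyP2 π) (P : GL (Fin d) ℂ) :
    Subgroup.closure {g : Γ | ∃ c b, (P * π g * P⁻¹ : GL (Fin d) ℂ).val - 1 = vecMulVec c b} =
      ⊤ := by
  set S' := {g : Γ | ∃ c b, (P * π g * P⁻¹ : GL (Fin d) ℂ).val - 1 = vecMulVec c b} with hS'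
  obtain ⟨S, hS, hSr⟩ := h
  have hmap : Subgroup.closure S ≤ (Subgroup.closure S').map π := by
    refine (Subgroup.closure_le _).2 fun A hA => ?_
    obtain ⟨g, rfl⟩ : A ∈ π.range := hSr ▸ Subgroup.subset_closure hA
    obtain ⟨c, b, hcb⟩ := exists_eq_vecMulVec_of_rank_le_one (hS _ hA).2.le
    refine ⟨g, Subgroup.subset_closure ⟨P.val *ᵥ c, b ᵥ* P⁻¹.val, ?_⟩, rfl⟩
    have h1 : P.val * P⁻¹.val = 1 := P.mul_inv
    rw [← vecMulVec_mul, ← mul_vecMulVec, ← hcb, Units.val_mul, Units.val_mul, mul_sub, mul_one,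
      sub_mul, h1]
  refine eq_top_iff.2 fun g _ => ?_
  obtain ⟨g', hg', hgg⟩ := hmap (hSr ▸ ⟨g, rfl⟩ : π g ∈ Subgroup.closure S)
  have h1 : g'⁻¹ * g ∈ S' := ⟨0, 0, by simp [hgg]⟩
  have := Subgroup.mul_mem _ hg' (Subgroup.subset_closure h1)
  rwa [mul_inv_cancel_left] at this

namespace OrientedGraph

variable {V E : Type*} [Fintype V] [DecidableEq V] {d : ℕ} {Γ : Type*} [Group Γ]

/-- The contribution of an edge to the covering matrix of a unitary representation. -/
noncomputable def edgeMatrix (G : OrientedGraph V E) (U : Γ → GL (Fin d) ℂ) (γ : E → Γ) (e : E) :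
    Matrix (V × Fin d) (V × Fin d) ℂ :=
  place (G.tail e) (G.head e) (U (γ e)).val + place (G.head e) (G.tail e) ((U (γ e)).val)ᴴ

theorem isHermitian_edgeMatrix (G : OrientedGraph V E) (U : Γ → GL (Fin d) ℂ) (γ : E → Γ) (e : E) :
    (G.edgeMatrix U γ e).IsHermitian := by
  rw [IsHermitian, edgeMatrix, conjTranspose_add, conjTranspose_place, conjTranspose_place,
    conjTranspose_conjTranspose, add_comm]

/-- If all the polynomials have a root above `l`, then so do their lazy averages along
reflections. -/
theorem exists_isInterlacing_lazyAverage [Fintype E] [DecidableEq E] [Nonempty (V × Fin d)]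
    (G : OrientedGraph V E) (hloop : G.Loopless) (U : Γ →* GL (Fin d) ℂ) {l : ℝ}
    (hl : ∀ γ, ∃ x, l < x ∧ (∑ e, G.edgeMatrix U γ e).realCharpoly.eval x = 0)
    (L : List (E → Γ)) (hL : ∀ s ∈ L, ∃ e, ∃ g ∈ {g : Γ | ∃ c b, (U g).val - 1 = vecMulVec c b},
      s = Pi.mulSingle e g) :
    ∃ F : (E → Matrix (V × Fin d) (V × Fin d) ℂ) → Polynomial ℝ, IsInterlacing F ∧
      (∀ γ x, (F (G.edgeMatrix U γ)).eval x =
        lazyAverage (fun γ => (∑ e, G.edgeMatrix U γ e).realCharpoly.eval x) L γ) ∧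
      ∀ γ, ∃ x, l < x ∧ (F (G.edgeMatrix U γ)).eval x = 0 := by
  induction L with
  | nil => exact ⟨_, IsInterlacing.realCharpoly_sum, fun γ x => rfl, hl⟩
  | cons s L ih =>
    obtain ⟨F, hF, hFL, hFl⟩ := ih fun s hs => hL s (List.mem_cons_of_mem _ hs)
    obtain ⟨e, g, ⟨c, b, hcb⟩, rfl⟩ := hL s List.mem_cons_self
    have hD : (1 : Matrix (V × Fin d) (V × Fin d) ℂ) +
        vecMulVec (blockInclusion d (G.tail e) c) (star (blockInclusion d (G.tail e) (star b))) =
        1 + place (G.tail e) (G.tail e) ((U g).val - 1) := by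
      rw [star_blockInclusion, star_star, ← place_vecMulVec, hcb]
    have hinv : IsUnit (1 + place (G.tail e) (G.tail e) ((U g).val - 1)) := by
      refine IsUnit.of_mul_eq_one (1 + place (G.tail e) (G.tail e) ((U g⁻¹).val - 1)) ?_
      rw [one_add_place_mul_one_add_place, ← Units.val_mul, ← map_mul, mul_inv_cancel, map_one]
      simp [place_eq_kronecker]
    set R : E → Matrix (V × Fin d) (V × Fin d) ℂ := Function.update (fun _ => 1) e
      (1 + place (G.tail e) (G.tail e) ((U g).val - 1)) with hR
    -- The congruence is applied to the summand of `e` alone, so it changes the label of `e` and no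
    -- other.
    have hcong : ∀ γ, (fun e' => R e' * G.edgeMatrix U γ e' * (R e')ᴴ) =
        G.edgeMatrix U (Pi.mulSingle e g * γ) := by
      intro γ
      funext e'
      by_cases he : e' = e
      · subst he
        rw [hR, Function.update_self, edgeMatrix, one_add_place_congruence (hloop e').symm,
          edgeMatrix, Pi.mul_apply, Pi.mulSingle_eq_same, map_mul, Units.val_mul]
      · rw [hR, Function.update_of_ne he, edgeMatrix, edgeMatrix, Pi.mul_apply,
          Pi.mulSingle_eq_of_ne he]
        simp
    rw [← hD] at hinv hR
    refine ⟨_, hF.average e _ _ R hR hinv, fun γ x => ?_, fun γ => ?_⟩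
    · rw [hcong, Polynomial.eval_C_mul, Polynomial.eval_add, hFL, hFL, lazyAverage]
    · exact hF.exists_root_average (G.isHermitian_edgeMatrix U γ) e _ _ R hR (hFl γ)
        (by rw [hcong]; exact hFl _)

end OrientedGraph

end

/-! ### The theorem -/

theorem mainTheorem2 {Γ : Type*} [Group Γ] [Finite Γ] {d : ℕ} (hd : 1 ≤ d)
    (π : Γ →* GL (Fin d) ℂ) (h1 : PropertyP1 π) (h2 : PropertyP2 π)
    {V E : Type*} [Fintype V] [DecidableEq V] [Fintype E] (G : OrientedGraph V E)
    (hconn : G.Connected) (hloop : G.Loopless) :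
    ∃ γ : G.Labeling Γ, G.IsOneSidedRamanujan π γ := by
  classical
  have := Fintype.ofFinite Γ
  have hV : Nonempty V := hconn.nonempty
  have hFin : Nonempty (Fin d) := ⟨⟨0, hd⟩⟩
  -- Taking the base vertex with the smallest `rho` gives the bound for all base vertices, without
  -- showing that `rho` is independent of them.
  obtain ⟨v, hv⟩ := Finite.exists_min G.rho
  obtain ⟨P, hP⟩ := exists_conj_conjTranspose_eq π
  set U : Γ →* GL (Fin d) ℂ := (MulAut.conj P).toMonoidHom.comp π with hU
  have hsum : ∀ γ : E → Γ, ∑ e, G.edgeMatrix U γ e = G.blockMatrix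
      (fun e => P.val * (π (γ e)).val * P⁻¹.val)
      (fun e => P.val * (π (γ e)⁻¹).val * P⁻¹.val) := by
    intro γ
    refine Finset.sum_congr rfl fun e _ => ?_
    rw [OrientedGraph.edgeMatrix]
    congr 2
    exact hP (γ e)
  have hchar : ∀ γ : E → Γ, (∑ e, G.edgeMatrix U γ e).charpoly =
      (G.coveringMatrix π (OrientedGraph.Labeling.ofEdges G γ)).charpoly := fun γ => by
    rw [hsum, G.charpoly_blockMatrix_conj, G.coveringMatrix_ofEdges]
  have hherm : ∀ γ : E → Γ, (∑ e, G.edgeMatrix U γ e).IsHermitian := fun γ => by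
    rw [Matrix.IsHermitian, Matrix.conjTranspose_sum]
    exact Finset.sum_congr rfl fun e _ => G.isHermitian_edgeMatrix U γ e
  have hpos : ∀ x, G.rho v < x →
      0 < ∑ γ : E → Γ, (∑ e, G.edgeMatrix U γ e).realCharpoly.eval x := by
    intro x hx
    obtain ⟨r, hr, hrx⟩ := G.exists_sum_det_pos hconn hloop v h1.isMixing hx
    have : ((∑ γ : E → Γ, (∑ e, G.edgeMatrix U γ e).realCharpoly.eval x : ℝ) : ℂ) = r := by
      rw [← hrx, Complex.ofReal_sum]
      refine Finset.sum_congr rfl fun γ _ => ?_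
      rw [← Polynomial.aeval_ofReal_complex, ← Polynomial.eval_map_algebraMap,
        (hherm γ).map_realCharpoly, hchar, G.coveringMatrix_ofEdges, Matrix.eval_charpoly,
        Matrix.scalar_apply, ← Matrix.smul_one_eq_diagonal]
    rw [Complex.ofReal_inj.1 this]
    exact hr
  obtain ⟨γ, hγ⟩ := exists_forall_eval_ne_zero
    (Subgroup.closure_mulSingle_eq_top (E := E) (h2.closure_eq_top P))
    (fun γ => (∑ e, G.edgeMatrix U γ e).realCharpoly) (fun γ => (hherm γ).monic_realCharpoly)
    (fun l hl L hL => by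
      obtain ⟨F, -, hFL, hF⟩ := G.exists_isInterlacing_lazyAverage hloop U hl L hL
      obtain ⟨x, hx, hx0⟩ := hF 1
      exact ⟨x, hx, by rw [← hFL, hx0]⟩) hpos
  refine ⟨OrientedGraph.Labeling.ofEdges G γ, fun μ hμ => ?_⟩
  rw [OrientedGraph.coveringSpectrum, ← hchar, (hherm γ).roots_charpoly_eq_eigenvalues,
    Multiset.mem_map] at hμ
  obtain ⟨i, -, rfl⟩ := hμ
  refine ⟨Complex.ofReal_im _, fun v₀ => (not_lt.1 fun hlt => hγ _ hlt ?_).trans (hv v₀)⟩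
  rw [Matrix.realCharpoly, dif_pos (hherm γ), Polynomial.eval_prod]
  exact Finset.prod_eq_zero (Finset.mem_univ i) (by simp)
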